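/- For $x_1,\dots,x_n\in\mathbb{R}^d$ and $y_1,\dots,y_n\in\mathbb{R}$ consider the least squares problem with unknown correspondence $$\min_{w,\pi}\ \sum_{i=1}^n \bigl(w^{\top}x_{\pi(i)}-y_i\bigr)^2, \qquad (*)$$ where $w$ ranges over $\mathbb{R}^d$ and $\pi$ over the permutations of $\{1,\dots,n\}$. Time is measured on a real random access machine: exact arithmetic operations ($+,-,\times,/$) on real numbers and comparisons of real numbers, addition, subtraction and comparison of natural numbers used as counters and addresses, memory accesses and control operations each take unit time; program constants are rational, and real numbers cannot be rounded to integers. There is an algorithm (one program for all $n$, $d$ and $\epsilon$) that, given any $n,d\ge 0$, any $x_1,\dots,x_n\in\mathbb{R}^d$, $y_1,\dots,y_n\in\mathbb{R}$ and any $\epsilon\in(0,1)$, halts and returns $w\in\mathbb{R}^d$ and a permutation $\pi$ of $\{1,\dots,n\}$ whose objective value in $(*)$ is at most $1+\epsilon$ times the minimum. For all $n\ge 2$ and $d\ge 1$ its running time is $(n/\epsilon)^{O(d)}$, that is, at most $(n/\epsilon)^{Cd}$ for an absolute constant $C$. In particular it is a fully polynomial-time approximation scheme in any constant dimension: for each fixed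 $d$ there is a constant $K$ such that for all $n\ge 0$ and all inputs in dimension $d$ the running time is at most $K\,(n+1/\epsilon)^K$. -/

import Mathlib

/-!
A real random access machine, presented as a small imperative language. A machine has
two memories, one holding natural numbers (used for counters and addresses) and one holding
real numbers. Each memory is a family of two-dimensional arrays; the name of the array is fixed in the
program text and the two indices are computed at run time. On natural numbers the machine can
add, subtract (truncated) and compare; on real numbers it can add, subtract, multiply, divide
and compare. Constants in programs are natural or rational numbers. There is no conversion of
real numbers to natural numbers (no rounding), and there is no multiplication of natural
numbers. Every memory access, arithmetic operation, comparison and control operation costs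
one unit of time.
-/

namespace RealRAM

/-- Contents of the memories: `s.nat a i j` is entry `(i, j)` of the array of natural numbers
with name `a`, and `s.real a i j` is entry `(i, j)` of the array of real numbers with name
`a`. -/
structure State where
  nat : ℕ → ℕ → ℕ → ℕ
  real : ℕ → ℕ → ℕ → ℝ

/-- Expressions with values in the natural numbers. -/
inductive NExpr where
  | const (k : ℕ)
  | get (a : ℕ) (i j : NExpr)
  | add (e f : NExpr)
  | sub (e f : NExpr)

/-- Value of an expression. Subtraction is truncated. -/
def NExpr.eval (s : State) : NExpr → ℕ
  | const k => k
  | get a i j => s.nat a (i.eval s) (j.eval s)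
  | add e f => e.eval s + f.eval s
  | sub e f => e.eval s - f.eval s

/-- Number of elementary operations needed to evaluate an expression. -/
def NExpr.cost : NExpr → ℕ
  | const _ => 1
  | get _ i j => i.cost + j.cost + 1
  | add e f => e.cost + f.cost + 1
  | sub e f => e.cost + f.cost + 1

/-- Expressions with values in the real numbers. -/
inductive RExpr where
  | const (q : ℚ)
  | get (a : ℕ) (i j : NExpr)
  | add (e f : RExpr)
  | sub (e f : RExpr)
  | mul (e f : RExpr)
  | div (e f : RExpr)

/-- Value of an expression; exact real arithmetic. Division by zero returns zero. -/
noncomputable def RExpr.eval (s : State) : RExpr → ℝ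
  | const q => (q : ℝ)
  | get a i j => s.real a (i.eval s) (j.eval s)
  | add e f => e.eval s + f.eval s
  | sub e f => e.eval s - f.eval s
  | mul e f => e.eval s * f.eval s
  | div e f => e.eval s / f.eval s

/-- Number of elementary operations needed to evaluate an expression. -/
def RExpr.cost : RExpr → ℕ
  | const _ => 1
  | get _ i j => i.cost + j.cost + 1
  | add e f => e.cost + f.cost + 1
  | sub e f => e.cost + f.cost + 1
  | mul e f => e.cost + f.cost + 1
  | div e f => e.cost + f.cost + 1

/-- Tests: comparisons of two natural numbers or of two real numbers, and their Boolean
combinations. -/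
inductive Test where
  | natLT (e f : NExpr)
  | realLT (e f : RExpr)
  | not (b : Test)
  | and (b c : Test)

/-- The test `b` succeeds in the state `s`. -/
def Test.Holds (s : State) : Test → Prop
  | natLT e f => e.eval s < f.eval s
  | realLT e f => e.eval s < f.eval s
  | not b => ¬ b.Holds s
  | and b c => b.Holds s ∧ c.Holds s

/-- Number of elementary operations needed to evaluate a test. -/
def Test.cost : Test → ℕ
  | natLT e f => e.cost + f.cost + 1
  | realLT e f => e.cost + f.cost + 1
  | not b => b.cost + 1
  | and b c => b.cost + c.cost + 1

/-- Programs. -/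
inductive Program where
  | skip
  /-- `a[i, j] := e` for an array of natural numbers. -/
  | setNat (a : ℕ) (i j e : NExpr)
  /-- `a[i, j] := e` for an array of real numbers. -/
  | setReal (a : ℕ) (i j : NExpr) (e : RExpr)
  /-- First `p`, then `q`. -/
  | seq (p q : Program)
  /-- If `b` then `p` else `q`. -/
  | branch (b : Test) (p q : Program)
  /-- While `b` do `p`. -/
  | loop (b : Test) (p : Program)

/-- The state after writing `v` into entry `(i, j)` of the array `a` of natural numbers. -/
def State.writeNat (s : State) (a i j v : ℕ) : State where
  nat := fun a' i' j' => if a' = a ∧ i' = i ∧ j' = j then v else s.nat a' i' j'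
  real := s.real

/-- The state after writing `v` into entry `(i, j)` of the array `a` of real numbers. -/
noncomputable def State.writeReal (s : State) (a i j : ℕ) (v : ℝ) : State where
  nat := s.nat
  real := fun a' i' j' => if a' = a ∧ i' = i ∧ j' = j then v else s.real a' i' j'

/-- `Exec p s s' t`: started in the state `s`, the program `p` halts in the state `s'` after
exactly `t` units of time. -/
inductive Exec : Program → State → State → ℕ → Prop where
  | skip (s : State) : Exec Program.skip s s 1
  | setNat (s : State) (a : ℕ) (i j e : NExpr) :
      Exec (Program.setNat a i j e) s (s.writeNat a (i.eval s) (j.eval s) (e.eval s))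
        (i.cost + j.cost + e.cost + 1)
  | setReal (s : State) (a : ℕ) (i j : NExpr) (e : RExpr) :
      Exec (Program.setReal a i j e) s (s.writeReal a (i.eval s) (j.eval s) (e.eval s))
        (i.cost + j.cost + e.cost + 1)
  | seq {p q : Program} {s s' s'' : State} {t t' : ℕ} :
      Exec p s s' t → Exec q s' s'' t' → Exec (Program.seq p q) s s'' (t + t')
  | branch_true {b : Test} {p q : Program} {s s' : State} {t : ℕ} :
      b.Holds s → Exec p s s' t → Exec (Program.branch b p q) s s' (b.cost + 1 + t)
  | branch_false {b : Test} {p q : Program} {s s' : State} {t : ℕ} :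
      ¬ b.Holds s → Exec q s s' t → Exec (Program.branch b p q) s s' (b.cost + 1 + t)
  | loop_true {b : Test} {p : Program} {s s' s'' : State} {t t' : ℕ} :
      b.Holds s → Exec p s s' t → Exec (Program.loop b p) s' s'' t' →
      Exec (Program.loop b p) s s'' (b.cost + 1 + t + t')
  | loop_false {b : Test} {p : Program} {s : State} :
      ¬ b.Holds s → Exec (Program.loop b p) s s (b.cost + 1)

/-- The machine is deterministic: the final state and the running time are functions of the
program and the initial state. -/
theorem Exec.deterministic {p : Program} {s s₁ s₂ : State} {t₁ t₂ : ℕ}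
    (h₁ : Exec p s s₁ t₁) (h₂ : Exec p s s₂ t₂) : s₁ = s₂ ∧ t₁ = t₂ := by
  induction h₁ generalizing s₂ t₂ with
  | skip s => cases h₂; exact ⟨rfl, rfl⟩
  | setNat s a i j e => cases h₂; exact ⟨rfl, rfl⟩
  | setReal s a i j e => cases h₂; exact ⟨rfl, rfl⟩
  | seq _ _ ih ih' =>
    cases h₂ with
    | seq h h' =>
      obtain ⟨rfl, rfl⟩ := ih h
      obtain ⟨rfl, rfl⟩ := ih' h'
      exact ⟨rfl, rfl⟩
  | branch_true hb _ ih =>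
    cases h₂ with
    | branch_true _ h => obtain ⟨rfl, rfl⟩ := ih h; exact ⟨rfl, rfl⟩
    | branch_false hb' _ => exact absurd hb hb'
  | branch_false hb _ ih =>
    cases h₂ with
    | branch_true hb' _ => exact absurd hb' hb
    | branch_false _ h => obtain ⟨rfl, rfl⟩ := ih h; exact ⟨rfl, rfl⟩
  | loop_true hb _ _ ih ih' =>
    cases h₂ with
    | loop_true _ h h' =>
      obtain ⟨rfl, rfl⟩ := ih h
      obtain ⟨rfl, rfl⟩ := ih' h'
      exact ⟨rfl, rfl⟩
    | loop_false hb' => exact absurd hb hb'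
  | loop_false hb =>
    cases h₂ with
    | loop_true hb' _ _ => exact absurd hb' hb
    | loop_false _ => exact ⟨rfl, rfl⟩

end RealRAM

/-- The least squares objective `∑ i, (wᵀ x_{π(i)} - y_i)²`. -/
def leastSquaresObjective {n d : ℕ} (x : Fin n → Fin d → ℝ) (y : Fin n → ℝ)
    (w : Fin d → ℝ) (π : Equiv.Perm (Fin n)) : ℝ :=
  ∑ i, (w ⬝ᵥ x (π i) - y i) ^ 2

/-- The objective value of `(w, π)` is at most `1 + ε` times the minimum of the objective over
all weight vectors and all permutations. -/
def IsApproxSolution {n d : ℕ} (x : Fin n → Fin d → ℝ) (y : Fin n → ℝ) (ε : ℝ)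
    (w : Fin d → ℝ) (π : Equiv.Perm (Fin n)) : Prop :=
  ∀ (w' : Fin d → ℝ) (π' : Equiv.Perm (Fin n)),
    leastSquaresObjective x y w π ≤ (1 + ε) * leastSquaresObjective x y w' π'

/-- The initial state of the machine on the input `(n, d, x, y, ε)`. The natural array `0` holds
`n` in entry `(0, 0)` and `d` in entry `(0, 1)`; the real array `0` holds the matrix with rows
`x₁, …, xₙ`; the real array `1` holds `y` in its column `0`; the real array `2` holds `ε` in
entry `(0, 0)`. All other entries are zero. -/
noncomputable def regressionInput {n d : ℕ} (x : Fin n → Fin d → ℝ) (y : Fin n → ℝ)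
    (ε : ℝ) : RealRAM.State where
  nat := fun a i j =>
    if a = 0 ∧ i = 0 ∧ j = 0 then n else if a = 0 ∧ i = 0 ∧ j = 1 then d else 0
  real := fun a i j =>
    if a = 0 then (if h : i < n ∧ j < d then x ⟨i, h.1⟩ ⟨j, h.2⟩ else 0)
    else if a = 1 then (if h : i < n ∧ j = 0 then y ⟨i, h.1⟩ else 0)
    else if a = 2 ∧ i = 0 ∧ j = 0 then ε
    else 0

/-- The state `s` displays the output `(w, π)`: column `0` of the real array `3` starts with the
entries of `w`, and column `0` of the natural array `1` starts with the values of `π`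
(indices are counted from zero). -/
def RegressionOutput {n d : ℕ} (s : RealRAM.State) (w : Fin d → ℝ)
    (π : Equiv.Perm (Fin n)) : Prop :=
  (∀ j : Fin d, s.real 3 j 0 = w j) ∧ ∀ i : Fin n, s.nat 1 i 0 = (π i : ℕ)

/-- On the input `(n, d, x, y, ε)` the program `p` halts within time `T` and outputs a weight
vector and a permutation whose objective value is at most `1 + ε` times the minimum. -/
def ApproximatesWithin (p : RealRAM.Program) {n d : ℕ} (x : Fin n → Fin d → ℝ)
    (y : Fin n → ℝ) (ε T : ℝ) : Prop :=
  ∃ (s : RealRAM.State) (t : ℕ), RealRAM.Exec p (regressionInput x y ε) s t ∧ (t : ℝ) ≤ T ∧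
    ∃ (w : Fin d → ℝ) (π : Equiv.Perm (Fin n)),
      RegressionOutput s w π ∧ IsApproxSolution x y ε w π

/-!
Why the problem has such an algorithm. For fixed `w` an optimal permutation is found by sorting:
by the rearrangement inequality, matching the predictions `wᵀ x_i` with the responses in sorted
order is optimal (`sum_sq_matchPerm_le`). So it suffices to produce a list of `(n / ε) ^ O(d)`
vectors `w` one of which is good enough.

Let `A = X T`, where `T` changes to the coordinates in which some of the data points form the
standard basis. A basis may be completed by unit vectors, but these are replaced by data points as
long as the corresponding column of `A` is nonzero. As long as an entry of `A` exceeds one in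
absolute value, a pivot step replaces a basis point by another point and increases the volume of
the basis. Hence no basis occurs twice, there are at most `(n + 1) ^ d` steps
(`basisPotential_lt_update`), and in the end all entries of `A` lie in `[-1, 1]` and the columns
without a basis point vanish. A vector of coordinates then consists of the predictions for the at
most `n` basis points and of entries that do not matter, and an error `η` in each of these
predictions changes every prediction by at most `n η` (`abs_dotProduct_sub_le`).

Let `a ^ 2` be the objective value of a competitor. Its predictions for the basis points differ by
at most `a` from the responses matched with these points. Trying all vectors of responses therefore
gives a value of at most `(n + 1) ^ 4 a ^ 2`, and the sum `L` of the absolute residuals of the best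
such vector satisfies `L ≤ (n + 1) ^ 3 a`. The number `L` serves as the scale that would otherwise
require a square root: either `L < a`, and then the vector found is already as good as the
competitor, or a grid of radius `L` and width `L / K` around the responses contains the competitor
up to an error of `L / K` in each coordinate. With `K` about `n ^ 5 / ε` this error costs a factor
`1 + ε` only (`approximation_guarantee`). There are `1 + n (2 K + 1)` values to try for each of the
`d` coordinates.

The program is verified with a Hoare logic for total correctness with time bounds: `Halts p s T Q`
says that `p`, started in `s`, halts within time `T` in a state satisfying `Q`. What a program
does not assign to is unchanged (`Exec.frame`), so that specifications mention only the arrays that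
a program writes.

The arrays of natural numbers are used as follows.
* `0`: the dimensions; `1`: the permutation of the best candidate so far.
* `2`: marks of the columns with a pivot; `3`, `4`, `5`: whether and where a pivot is possible.
* `6`, `7`, `8`: loop counters; `9`: the number `K`; `10`: the number of grid points.
* `11`: the grid points selected for the coordinates; `12`, `13`, `14`: positions in sorted orders
  and the inverse of such a list; `15`: the permutation of the current candidate.
* `16`: whether a candidate has been stored; `17`: whether the enumeration has finished.

The arrays of real numbers are used as follows.
* `0`: the data points, later the matrix `A`; `1`: the responses; `2`: the number `ε`.
* `3`: the resulting vector; `4`: the matrix `T`; `5`, `6`: the pivot row, reduced by one at the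
  pivot, and the pivot.
* `7`: an intermediate result; `8`, `9`: the numbers `n + 1` and `K`.
* `10`: the grid points; `11`, `12`: coordinates and predictions of the current candidate.
* `13`, `14`: its objective value and its sum of absolute residuals.
* `15`, `16`, `17`: the same for the best candidate, and its coordinates.
* `18`: the number `3 (n + 1) ^ 5`; `19`, `20`: the current grid point and the width of the grid.
-/

/-! ### Program logic with time bounds -/

namespace RealRAM

/-- Names of the arrays of natural numbers that occur as the target of an assignment. -/
def Program.natTargets : Program → List ℕ
  | skip => []
  | setNat a _ _ _ => [a]
  | setReal _ _ _ _ => []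
  | seq p q => p.natTargets ++ q.natTargets
  | branch _ p q => p.natTargets ++ q.natTargets
  | loop _ p => p.natTargets

/-- Names of the arrays of real numbers that occur as the target of an assignment. -/
def Program.realTargets : Program → List ℕ
  | skip => []
  | setNat _ _ _ _ => []
  | setReal a _ _ _ => [a]
  | seq p q => p.realTargets ++ q.realTargets
  | branch _ p q => p.realTargets ++ q.realTargets
  | loop _ p => p.realTargets

/-- The states `s` and `s'` agree on all arrays that `p` does not assign to. -/
structure Frame (p : Program) (s s' : State) : Prop where
  nat : ∀ a, a ∉ p.natTargets → s'.nat a = s.nat a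
  real : ∀ a, a ∉ p.realTargets → s'.real a = s.real a

theorem Frame.refl (p : Program) (s : State) : Frame p s s :=
  ⟨fun _ _ => rfl, fun _ _ => rfl⟩

theorem Frame.trans {p : Program} {s s' s'' : State} (h : Frame p s s') (h' : Frame p s' s'') :
    Frame p s s'' :=
  ⟨fun a ha => (h'.nat a ha).trans (h.nat a ha), fun a ha => (h'.real a ha).trans (h.real a ha)⟩

theorem Frame.mono {p q : Program} {s s' : State} (h : Frame p s s')
    (hn : p.natTargets ⊆ q.natTargets) (hr : p.realTargets ⊆ q.realTargets) : Frame q s s' :=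
  ⟨fun a ha => h.nat a fun h => ha (hn h), fun a ha => h.real a fun h => ha (hr h)⟩

theorem Exec.frame {p : Program} {s s' : State} {t : ℕ} (h : Exec p s s' t) : Frame p s s' := by
  induction h with
  | skip s => exact Frame.refl _ _
  | setNat s a i j e =>
    refine ⟨fun b hb => ?_, fun b hb => rfl⟩
    funext i' j'
    simp only [Program.natTargets, List.mem_singleton] at hb
    simp [State.writeNat, hb]
  | setReal s a i j e =>
    refine ⟨fun b hb => rfl, fun b hb => ?_⟩
    funext i' j'
    simp only [Program.realTargets, List.mem_singleton] at hb
    simp [State.writeReal, hb]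
  | seq _ _ ih ih' =>
    exact (ih.mono (List.subset_append_left _ _) (List.subset_append_left _ _)).trans
      (ih'.mono (List.subset_append_right _ _) (List.subset_append_right _ _))
  | branch_true _ _ ih =>
    exact ih.mono (List.subset_append_left _ _) (List.subset_append_left _ _)
  | branch_false _ _ ih =>
    exact ih.mono (List.subset_append_right _ _) (List.subset_append_right _ _)
  | loop_true _ _ _ ih ih' =>
    exact Frame.trans (ih.mono (List.Subset.refl _) (List.Subset.refl _)) ih'
  | loop_false _ => exact Frame.refl _ _

/-- Total correctness with a time bound: started in `s`, the program `p` halts within `T` units of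
time in a state that satisfies `Q`. -/
def Halts (p : Program) (s : State) (T : ℕ) (Q : State → Prop) : Prop :=
  ∃ s' t, Exec p s s' t ∧ t ≤ T ∧ Q s'

namespace Halts

variable {p q : Program} {s : State} {T T' : ℕ} {Q R : State → Prop}

theorem mono (h : Halts p s T Q) (hT : T ≤ T') (hQ : ∀ s', Frame p s s' → Q s' → R s') :
    Halts p s T' R := by
  obtain ⟨s', t, he, ht, hq⟩ := h
  exact ⟨s', t, he, ht.trans hT, hQ s' he.frame hq⟩

theorem weaken (h : Halts p s T Q) (hQ : ∀ s', Frame p s s' → Q s' → R s') : Halts p s T R :=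
  h.mono le_rfl hQ

theorem time (h : Halts p s T Q) (hT : T ≤ T') : Halts p s T' Q :=
  h.mono hT fun _ _ h => h

theorem skip (h : Q s) (hT : 1 ≤ T := by decide) : Halts Program.skip s T Q :=
  ⟨s, 1, .skip s, hT, h⟩

theorem setNat {a : ℕ} {i j e : NExpr} (h : Q (s.writeNat a (i.eval s) (j.eval s) (e.eval s)))
    (hT : i.cost + j.cost + e.cost + 1 ≤ T := by simp [NExpr.cost, RExpr.cost]) :
    Halts (.setNat a i j e) s T Q :=
  ⟨_, _, .setNat s a i j e, hT, h⟩

theorem setReal {a : ℕ} {i j : NExpr} {e : RExpr}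
    (h : Q (s.writeReal a (i.eval s) (j.eval s) (e.eval s)))
    (hT : i.cost + j.cost + e.cost + 1 ≤ T := by simp [NExpr.cost, RExpr.cost]) :
    Halts (.setReal a i j e) s T Q :=
  ⟨_, _, .setReal s a i j e, hT, h⟩

theorem seq (hp : Halts p s T R) (hq : ∀ s', Frame p s s' → R s' → Halts q s' T' Q) :
    Halts (.seq p q) s (T + T') Q := by
  obtain ⟨s', t, he, ht, hr⟩ := hp
  obtain ⟨s'', t', he', ht', hr'⟩ := hq s' he.frame hr
  exact ⟨s'', _, .seq he he', add_le_add ht ht', hr'⟩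

theorem branch {b : Test} (hp : b.Holds s → Halts p s T Q) (hq : ¬ b.Holds s → Halts q s T Q)
    (hT : b.cost + 1 ≤ 60 := by decide) : Halts (.branch b p q) s (T + 60) Q := by
  by_cases hb : b.Holds s
  · obtain ⟨s', t, he, ht, h⟩ := hp hb
    exact ⟨s', _, .branch_true hb he, by omega, h⟩
  · obtain ⟨s', t, he, ht, h⟩ := hq hb
    exact ⟨s', _, .branch_false hb he, by omega, h⟩

/-- The rule for loops. The parameter `v` of the invariant is a natural number that every round
decreases, so it bounds the number of rounds. -/
theorem loop {b : Test} (I : ℕ → State → Prop) {v : ℕ} (h0 : I v s)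
    (hstep : ∀ v s', Frame (.loop b p) s s' → I v s' → b.Holds s' →
      Halts p s' T fun s'' => ∃ v' < v, I v' s'') :
    Halts (.loop b p) s ((v + 1) * (T + b.cost + 1))
      fun s' => ¬ b.Holds s' ∧ ∃ v', I v' s' := by
  suffices H : ∀ s', Frame (.loop b p) s s' → I v s' →
      Halts (.loop b p) s' ((v + 1) * (T + b.cost + 1)) fun s' => ¬ b.Holds s' ∧ ∃ v', I v' s' from
      H s (Frame.refl _ _) h0
  clear h0
  induction v using Nat.strong_induction_on with
  | _ v ih =>
    intro s' hF hI
    by_cases hb : b.Holds s'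
    · obtain ⟨s₁, t₁, he₁, ht₁, v', hv', hI'⟩ := hstep v s' hF hI hb
      obtain ⟨s₂, t₂, he₂, ht₂, h₂⟩ := ih v' hv' s₁
        (hF.trans (he₁.frame.mono (List.Subset.refl _) (List.Subset.refl _))) hI'
      refine ⟨s₂, _, .loop_true hb he₁ he₂, ?_, h₂⟩
      have : (v' + 1) * (T + b.cost + 1) ≤ v * (T + b.cost + 1) := Nat.mul_le_mul_right _ hv'
      rw [add_mul]
      omega
    · exact ⟨s', _, .loop_false hb, by rw [add_mul]; omega, hb, v, hI⟩

end Halts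

/-- Entry `(0, 0)` of an array of natural numbers, used as a variable. -/
abbrev natVar (a : ℕ) : NExpr := .get a (.const 0) (.const 0)

/-- Entry `(0, 0)` of an array of real numbers, used as a variable. -/
abbrev realVar (a : ℕ) : RExpr := .get a (.const 0) (.const 0)

/-- For `v = 0, …, e - 1` do `p`. -/
def forLoop (v : ℕ) (e : NExpr) (p : Program) : Program :=
  .seq (.setNat v (.const 0) (.const 0) (.const 0))
    (.loop (.natLT (natVar v) e)
      (.seq p (.setNat v (.const 0) (.const 0) (.add (natVar v) (.const 1)))))

/-- The rule for counting loops: `I k` holds before round `k`. The bound `e` may be any expression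
of cost at most `15` that the loop does not change; a round then costs at most `32` more than its
body, which includes a share of the initialization and of the last test. -/
theorem Halts.forLoop {v : ℕ} {e : NExpr} {p : Program} {s : State} {T N : ℕ}
    (I : ℕ → State → Prop) (hv : v ∉ p.natTargets) (hc : e.cost ≤ 15)
    (he : ∀ s', Frame (forLoop v e p) s s' → e.eval s' = N)
    (h0 : I 0 (s.writeNat v 0 0 0))
    (hstep : ∀ k < N, ∀ s', Frame (RealRAM.forLoop v e p) s s' → s'.nat v 0 0 = k → I k s' →
      Halts p s' T fun s'' => I (k + 1) (s''.writeNat v 0 0 (k + 1))) :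
    Halts (RealRAM.forLoop v e p) s ((N + 1) * (T + 32)) (I N) := by
  have hF : ∀ s', Frame (.loop (.natLT (natVar v) e)
      (.seq p (.setNat v (.const 0) (.const 0) (.add (natVar v) (.const 1)))))
      (s.writeNat v 0 0 0) s' → Frame (RealRAM.forLoop v e p) s s' := by
    intro s' h
    refine Frame.trans (s' := s.writeNat v 0 0 0) ?_ (h.mono ?_ ?_)
    · exact (Exec.setNat s v (.const 0) (.const 0) (.const 0)).frame.mono
        (List.subset_append_left _ _) (List.subset_append_left _ _)
    · exact List.subset_append_right _ _
    · exact List.subset_append_right _ _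
  have hl := Halts.loop (b := .natLT (natVar v) e)
    (p := .seq p (.setNat v (.const 0) (.const 0) (.add (natVar v) (.const 1))))
    (T := T + 8) (v := N) (s := s.writeNat v 0 0 0)
    (fun r s' => r + s'.nat v 0 0 = N ∧ I (s'.nat v 0 0) s') ?_ ?_
  · refine (Halts.seq (R := fun s' => s' = s.writeNat v 0 0 0) (Halts.setNat (T := 4) rfl) ?_).time
      (T := _ + (N + 1) * (T + 8 + (3 + e.cost + 1) + 1)) ?_
    · rintro s' - rfl
      refine hl.weaken fun s' hs h => ?_
      obtain ⟨hb, r, hr, hI⟩ := h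
      simp only [Test.Holds, NExpr.eval, he s' (hF s' hs), not_lt] at hb
      have : s'.nat v 0 0 = N := by omega
      rwa [this] at hI
    · have := Nat.mul_le_mul_left (N + 1)
        (show T + 8 + (3 + e.cost + 1) + 1 + 4 ≤ T + 32 by omega)
      rw [mul_add (N + 1) _ 4] at this
      omega
  · simpa [State.writeNat] using h0
  · rintro r s' hF' ⟨hr, hI⟩ hb
    simp only [Test.Holds, he s' (hF s' hF')] at hb
    change s'.nat v 0 0 < N at hb
    refine (Halts.seq (hstep (s'.nat v 0 0) hb s' (hF s' hF') rfl hI) ?_ : Halts _ _ (T + 8) _)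
    intro s'' hF'' hI'
    have hk : s''.nat v = s'.nat v := hF''.nat v hv
    refine Halts.setNat ?_
    simp only [NExpr.eval, hk]
    refine ⟨r - 1, by omega, ?_, ?_⟩
    · simp [State.writeNat]; omega
    · simpa [State.writeNat] using hI'

end RealRAM

/-! ### Pivot steps -/

namespace RealRAM

theorem Halts.seq_left {p q : Program} {s : State} {T T' : ℕ} {Q : State → Prop}
    (h : Halts p s T fun s' => Halts q s' T' Q) : Halts (.seq p q) s (T + T') Q :=
  h.seq fun _ _ h => h

/-- Entry `(i, 0)` of an array of natural numbers. -/
abbrev natAt (a : ℕ) (i : NExpr) : NExpr := .get a i (.const 0)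

/-- Entry `(i, 0)` of an array of real numbers. -/
abbrev realAt (a : ℕ) (i : NExpr) : RExpr := .get a i (.const 0)

/-- Assignment to entry `(i, 0)` of an array of natural numbers. -/
abbrev setNatAt (a : ℕ) (i e : NExpr) : Program := .setNat a i (.const 0) e

/-- Assignment to entry `(i, 0)` of an array of real numbers. -/
abbrev setRealAt (a : ℕ) (i : NExpr) (e : RExpr) : Program := .setReal a i (.const 0) e

/-- Assignment to a natural variable. -/
abbrev setNatVar (a : ℕ) (e : NExpr) : Program := setNatAt a (.const 0) e

/-- Assignment to a real variable. -/
abbrev setRealVar (a : ℕ) (e : RExpr) : Program := setRealAt a (.const 0) e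

/-- The number `n` of data points. -/
abbrev dimN : NExpr := natVar 0

/-- The dimension `d`. -/
abbrev dimD : NExpr := .get 0 (.const 0) (.const 1)

/-- Real array `4` becomes the identity matrix of size `d`. -/
def initTransform : Program :=
  forLoop 6 dimD (.setReal 4 (natVar 6) (natVar 6) (.const 1))

theorem halts_initTransform (s : State) {d : ℕ} (hd : s.nat 0 0 1 = d) :
    Halts initTransform s ((d + 1) * 40) fun s' =>
      ∀ i j, s'.real 4 i j = if i = j ∧ i < d then 1 else s.real 4 i j := by
  refine Halts.forLoop (T := 8)
    (fun k s' => ∀ i j, s'.real 4 i j = if i = j ∧ i < k then 1 else s.real 4 i j)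
    (by decide) (by decide) ?_ ?_ ?_
  · intro s' hF
    simp [NExpr.eval, hF.nat 0 (by decide), hd]
  · simp [State.writeNat]
  · intro k hk s' hF hk' hI
    refine Halts.setReal ?_
    intro i j
    simp only [NExpr.eval, RExpr.eval, State.writeNat, State.writeReal, hk', hI]
    by_cases h : i = k ∧ j = k
    · simp [h.1, h.2]
    · have : (i = j ∧ i < k + 1) ↔ (i = j ∧ i < k) := by omega
      simp only [this]
      simp [h]

/-- The condition on entry `(i, j)` of `A` under which the basis is changed by a pivot step: the
entry is nonzero and column `j` has no pivot yet, or the entry exceeds one in absolute value. -/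
def CanPivot (s : State) (i j : ℕ) : Prop :=
  (0 < s.real 0 i j * s.real 0 i j ∧ s.nat 2 j 0 < 1) ∨ 1 < s.real 0 i j * s.real 0 i j

/-- The test for `CanPivot` at the entry addressed by the variables `6` and `7`. -/
def pivotTest : Test :=
  .not (.and
    (.not (.and
      (.realLT (.const 0) (.mul (.get 0 (natVar 6) (natVar 7)) (.get 0 (natVar 6) (natVar 7))))
      (.natLT (natAt 2 (natVar 7)) (.const 1))))
    (.not (.realLT (.const 1)
      (.mul (.get 0 (natVar 6) (natVar 7)) (.get 0 (natVar 6) (natVar 7))))))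

theorem holds_pivotTest (s : State) :
    pivotTest.Holds s ↔ CanPivot s (s.nat 6 0 0) (s.nat 7 0 0) := by
  simp only [pivotTest, Test.Holds, CanPivot, NExpr.eval, RExpr.eval, Rat.cast_zero, Rat.cast_one]
  tauto

/-- Look for a possible pivot; variable `3` tells whether there is one, and variables `4` and `5`
hold its position. -/
def searchPivot : Program :=
  .seq (setNatVar 3 (.const 0))
    (forLoop 6 dimN (forLoop 7 dimD (.branch pivotTest
      (.seq (setNatVar 3 (.const 1)) (.seq (setNatVar 4 (natVar 6)) (setNatVar 5 (natVar 7))))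
      .skip)))

/-- The outcome of `searchPivot` when all entries satisfying `P` have been inspected. -/
def SearchResult (s : State) (n d : ℕ) (P : ℕ → ℕ → Prop) : Prop :=
  (s.nat 3 0 0 = 0 → ∀ i j, P i j → ¬ CanPivot s i j) ∧
    (s.nat 3 0 0 ≠ 0 → s.nat 4 0 0 < n ∧ s.nat 5 0 0 < d ∧
      CanPivot s (s.nat 4 0 0) (s.nat 5 0 0))

theorem halts_searchPivot (s : State) {n d : ℕ} (hn : s.nat 0 0 0 = n) (hd : s.nat 0 0 1 = d) :
    Halts searchPivot s (20 + (n + 1) * ((d + 1) * 110 + 32)) fun s' =>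
      SearchResult s' n d fun i j => i < n ∧ j < d := by
  refine Halts.seq_left (Halts.setNat ?_)
  refine (Halts.forLoop (N := n) (T := (d + 1) * 110)
    (fun k s' => SearchResult s' n d fun i j => i < k ∧ j < d)
    (by decide) (by decide) ?_ ?_ ?_)
  · intro s' hF
    simp [NExpr.eval, hF.nat 0 (by decide), State.writeNat, hn]
  · simp [SearchResult, State.writeNat, NExpr.eval]
  · intro i hi s₁ hF₁ hi₁ hI₁
    have hF₁0 := hF₁.nat 0 (by decide)
    refine (Halts.forLoop (N := d) (T := 78)
      (fun k s' => SearchResult s' n d fun i' j' => i' < i ∧ j' < d ∨ i' = i ∧ j' < k)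
      (by decide) (by decide) ?_ ?_ ?_).weaken ?_
    · intro s' hF
      simp [NExpr.eval, hF.nat 0 (by decide), hF₁0, State.writeNat, hd]
    · simpa [SearchResult, State.writeNat, NExpr.eval, CanPivot] using hI₁
    · intro j hj s₂ hF₂ hj₂ hI₂
      have hi₂ : s₂.nat 6 0 0 = i := by rw [hF₂.nat 6 (by decide), hi₁]
      refine Halts.branch (T := 18) ?_ ?_
      · intro hb
        rw [holds_pivotTest, hi₂, hj₂] at hb
        refine Halts.seq_left (T := 6) (T' := 6 + 6) (Halts.setNat ?_)
        refine Halts.seq_left (Halts.setNat ?_)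
        refine Halts.setNat ?_
        refine ⟨fun h => ?_, fun h => ?_⟩
        · simp [State.writeNat, NExpr.eval] at h
        · simp only [CanPivot] at hb
          simpa [State.writeNat, NExpr.eval, hi₂, hj₂, hi, hj, CanPivot] using hb
      · intro hb
        rw [holds_pivotTest, hi₂, hj₂] at hb
        refine Halts.skip ?_
        refine ⟨fun h i' j' hP => ?_, fun h => ?_⟩
        · have h' : s₂.nat 3 0 0 = 0 := by simpa [State.writeNat] using h
          have := hI₂.1 h' i' j'
          simp only [CanPivot, State.writeNat] at this hb ⊢
          by_cases hij : i' = i ∧ j' = j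
          · obtain ⟨rfl, rfl⟩ := hij
            simpa using hb
          · simpa using this (by omega)
        · have h' : s₂.nat 3 0 0 ≠ 0 := by simpa [State.writeNat] using h
          have := hI₂.2 h'
          simpa [CanPivot, State.writeNat] using this
    · intro s₂ hF₂ hI₂
      refine ⟨fun h i' j' hP => ?_, fun h => ?_⟩
      · have h' : s₂.nat 3 0 0 = 0 := by simpa [State.writeNat] using h
        have := hI₂.1 h' i' j' (by omega)
        simpa [CanPivot, State.writeNat] using this
      · have h' : s₂.nat 3 0 0 ≠ 0 := by simpa [State.writeNat] using h
        have := hI₂.2 h'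
        simpa [CanPivot, State.writeNat] using this

/-- Subtract from the real array `a`, with `e` rows, the product of its column `q`, divided by
real variable `6`, and the row in real array `5`; the number `q` is in variable `5`. -/
def sweep (a : ℕ) (e : NExpr) : Program :=
  forLoop 6 e (.seq
    (setRealVar 7 (.div (.get a (natVar 6) (natVar 5)) (realVar 6)))
    (forLoop 7 dimD (.setReal a (natVar 6) (natVar 7)
      (.sub (.get a (natVar 6) (natVar 7)) (.mul (realVar 7) (realAt 5 (natVar 7)))))))

/-- The quotient of the entry in column `q` and the pivot is read before its row is changed, so the
specification refers to the old matrix throughout. -/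
theorem halts_sweep (s : State) {a : ℕ} {e : NExpr} {N d : ℕ} (ha : a = 0 ∨ a = 4)
    (hc : e.cost ≤ 15) (he : ∀ s', Frame (sweep a e) s s' → e.eval s' = N)
    (hd : s.nat 0 0 1 = d) :
    Halts (sweep a e) s ((N + 1) * (20 + (d + 1) * 70 + 32)) fun s' => ∀ i j,
      s'.real a i j = if i < N ∧ j < d then
        s.real a i j - s.real a i (s.nat 5 0 0) / s.real 6 0 0 * s.real 5 j 0
      else s.real a i j := by
  have ha5 : 5 ∉ (sweep a e).realTargets := by
    rcases ha with rfl | rfl <;> simp [sweep, Program.realTargets, forLoop]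
  have ha6 : 6 ∉ (sweep a e).realTargets := by
    rcases ha with rfl | rfl <;> simp [sweep, Program.realTargets, forLoop]
  have ha7 : a ≠ 7 := by omega
  have hn0 : 0 ∉ (sweep a e).natTargets := by simp [sweep, Program.natTargets, forLoop]
  have hn5 : 5 ∉ (sweep a e).natTargets := by simp [sweep, Program.natTargets, forLoop]
  refine Halts.forLoop (fun k s' => ∀ i j, s'.real a i j = if i < k ∧ j < d then
        s.real a i j - s.real a i (s.nat 5 0 0) / s.real 6 0 0 * s.real 5 j 0
      else s.real a i j) (by simp [Program.natTargets, forLoop]) hc he ?_ ?_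
  · simp [State.writeNat]
  · intro i hi s₁ hF₁ hi₁ hI₁
    refine Halts.seq_left (Halts.setReal ?_)
    refine (Halts.forLoop (N := d) (T := 38) (fun k s' => ∀ i' j',
      s'.real a i' j' = if (i' < i ∧ j' < d) ∨ (i' = i ∧ j' < k) then
        s.real a i' j' - s.real a i' (s.nat 5 0 0) / s.real 6 0 0 * s.real 5 j' 0
      else s.real a i' j') ?_ (by decide) ?_ ?_ ?_).weaken ?_
    · simp [Program.natTargets]
    · intro s' hF
      have h0 := hF.nat 0 (by simp [Program.natTargets, forLoop])
      simp [NExpr.eval, h0, hF₁.nat 0 hn0, State.writeReal, hd]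
    · intro i' j'
      simp [State.writeNat, State.writeReal, ha7, hI₁]
    · intro j hj s₂ hF₂ hj₂ hI₂
      have hi₂ : s₂.nat 6 0 0 = i := by
        rw [hF₂.nat 6 (by simp [Program.natTargets, forLoop])]
        simpa [State.writeReal] using hi₁
      have h7 : s₂.real 7 0 0 = s.real a i (s.nat 5 0 0) / s.real 6 0 0 := by
        rw [hF₂.real 7 (by simp [Program.realTargets, forLoop, ha7.symm])]
        simp [State.writeReal, RExpr.eval, NExpr.eval, hi₁, hF₁.real 6 ha6, hF₁.nat 5 hn5, hI₁]
      have h5 : s₂.real 5 = s.real 5 := by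
        rw [hF₂.real 5 (by rcases ha with rfl | rfl <;> decide), ← hF₁.real 5 ha5]
        simp [State.writeReal]
      refine Halts.setReal ?_
      intro i' j'
      simp only [NExpr.eval, RExpr.eval, State.writeNat, State.writeReal, hj₂, hi₂, hI₂, h7, h5]
      by_cases h : i' = i ∧ j' = j
      · obtain ⟨rfl, rfl⟩ := h
        simp
      · have : ((i' < i ∧ j' < d) ∨ (i' = i ∧ j' < j + 1)) ↔
          ((i' < i ∧ j' < d) ∨ (i' = i ∧ j' < j)) := by omega
        simp only [this]
        simp [h]
    · intro s₂ hF₂ hI₂ i' j'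
      have : ((i' < i ∧ j' < d) ∨ (i' = i ∧ j' < d)) ↔ (i' < i + 1 ∧ j' < d) := by omega
      simp [State.writeNat, hI₂, this]

/-- The pivot step at the position held in variables `4` and `5`. -/
def pivot : Program :=
  .seq (forLoop 7 dimD (setRealAt 5 (natVar 7) (.get 0 (natVar 4) (natVar 7))))
    (.seq (setRealVar 6 (.get 0 (natVar 4) (natVar 5)))
      (.seq (setRealAt 5 (natVar 5) (.sub (realAt 5 (natVar 5)) (.const 1)))
        (.seq (sweep 0 dimN) (.seq (sweep 4 dimD) (setNatAt 2 (natVar 5) (.const 1))))))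

theorem halts_pivot (s : State) {n d p q : ℕ} (hn : s.nat 0 0 0 = n) (hd : s.nat 0 0 1 = d)
    (hp : s.nat 4 0 0 = p) (hq : s.nat 5 0 0 = q) (hqd : q < d) :
    Halts pivot s ((d + 1) * 44 + (20 + (20 + ((n + 1) * (20 + (d + 1) * 70 + 32) +
      ((d + 1) * (20 + (d + 1) * 70 + 32) + 20))))) fun s' =>
      (∀ i j, i < n → j < d → s'.real 0 i j = s.real 0 i j -
        s.real 0 i q / s.real 0 p q * (s.real 0 p j - if j = q then 1 else 0)) ∧
      (∀ i j, i < d → j < d → s'.real 4 i j = s.real 4 i j -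
        s.real 4 i q / s.real 0 p q * (s.real 0 p j - if j = q then 1 else 0)) ∧
      ∀ j, s'.nat 2 j 0 = if j = q then 1 else s.nat 2 j 0 := by
  have h1 : Halts (forLoop 7 dimD (setRealAt 5 (natVar 7) (.get 0 (natVar 4) (natVar 7)))) s
      ((d + 1) * 44) fun s' => ∀ j, j < d → s'.real 5 j 0 = s.real 0 p j := by
    refine Halts.forLoop (T := 12)
      (fun k s' => ∀ j, j < k → s'.real 5 j 0 = s.real 0 p j) (by decide) (by decide) ?_ ?_ ?_
    · intro s' hF
      simp [NExpr.eval, hF.nat 0 (by decide), hd]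
    · simp
    · intro k hk s' hF hk' hI
      refine Halts.setReal ?_
      intro j hj
      by_cases hjk : j = k
      · simp [NExpr.eval, RExpr.eval, State.writeNat, State.writeReal, hk', hjk,
          hF.nat 4 (by decide), hF.real 0 (by decide), hp]
      · simpa [NExpr.eval, RExpr.eval, State.writeNat, State.writeReal, hk', hjk] using
          hI j (by omega)
  refine h1.seq fun s₁ hF₁ h₁ => ?_
  have hn₁ : s₁.nat 0 = s.nat 0 := hF₁.nat 0 (by decide)
  have hq₁ : s₁.nat 5 0 0 = q := by rw [hF₁.nat 5 (by decide), hq]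
  have hp₁ : s₁.nat 4 0 0 = p := by rw [hF₁.nat 4 (by decide), hp]
  have h2₁ : s₁.nat 2 = s.nat 2 := hF₁.nat 2 (by decide)
  have hA₁ : s₁.real 0 = s.real 0 := hF₁.real 0 (by decide)
  have hT₁ : s₁.real 4 = s.real 4 := hF₁.real 4 (by decide)
  refine Halts.seq_left (Halts.setReal ?_)
  refine Halts.seq_left (Halts.setReal ?_)
  simp only [NExpr.eval, RExpr.eval, hp₁, hq₁, hA₁]
  set s₂ : State := (s₁.writeReal 6 0 0 (s.real 0 p q)) with hs₂
  have e₂ : s₂.nat = s₁.nat := rfl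
  simp only [e₂, hq₁]
  have e₃ : s₂.real 5 q 0 = s.real 0 p q := by
    simp [s₂, State.writeReal, h₁ q hqd]
  rw [e₃]
  set s₃ : State := s₂.writeReal 5 q 0 (s.real 0 p q - (1 : ℚ)) with hs₃
  have e₃n : s₃.nat = s₁.nat := rfl
  have e₃6 : s₃.real 6 0 0 = s.real 0 p q := by simp [s₃, s₂, State.writeReal]
  have e₃0 : s₃.real 0 = s.real 0 := by funext i j; simp [s₃, s₂, State.writeReal, hA₁]
  have e₃4 : s₃.real 4 = s.real 4 := by funext i j; simp [s₃, s₂, State.writeReal, hT₁]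
  have e₃5 : ∀ j, j < d → s₃.real 5 j 0 = s.real 0 p j - if j = q then 1 else 0 := by
    intro j hj
    by_cases hjq : j = q
    · simp [s₃, State.writeReal, hjq]
    · simp [s₃, s₂, State.writeReal, hjq, h₁ j hj]
  refine (halts_sweep s₃ (N := n) (.inl rfl) (by decide) ?_ (by rw [e₃n, hn₁, hd])).seq ?_
  · intro s' hF
    simp [NExpr.eval, hF.nat 0 (by decide), e₃n, hn₁, hn]
  intro s₄ hF₄ h₄
  have e₄n : s₄.nat 0 = s.nat 0 := by rw [hF₄.nat 0 (by decide), e₃n, hn₁]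
  refine (halts_sweep s₄ (N := d) (.inr rfl) (by decide) ?_ (by rw [e₄n, hd])).seq ?_
  · intro s' hF
    simp [NExpr.eval, hF.nat 0 (by decide), e₄n, hd]
  intro s₅ hF₅ h₅
  have e₄5 : s₄.nat 5 = s₁.nat 5 := hF₄.nat 5 (by decide)
  have e₅5 : s₅.nat 5 0 0 = q := by rw [hF₅.nat 5 (by decide), e₄5, hq₁]
  refine Halts.setNat ⟨?_, ?_, ?_⟩
  · intro i j hi hj
    simp only [State.writeNat, hF₅.real 0 (by decide), h₄, hi, hj, and_self, if_true, e₃0, e₃n,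
      hq₁, e₃6, e₃5 j hj]
  · intro i j hi hj
    simp only [State.writeNat, h₅, hi, hj, and_self, if_true, hF₄.real 4 (by decide), e₃4, e₄5,
      hF₄.real 5 (by decide), hF₄.real 6 (by decide),
      hq₁, e₃6, e₃5 j hj]
  · intro j
    simp only [State.writeNat, NExpr.eval, e₅5, hF₅.nat 2 (by decide), hF₄.nat 2 (by decide),
      e₃n, h2₁]
    simp

end RealRAM

/-! ### Change of basis -/

section Basis

variable {n d : ℕ}

/-- The square matrix whose row `j` is the data point `X i` if `b j = some i`, and the standard
basis vector `e_j` if `b j = none`. -/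
def basisMatrix (X : Matrix (Fin n) (Fin d) ℝ) (b : Fin d → Option (Fin n)) :
    Matrix (Fin d) (Fin d) ℝ :=
  Matrix.of fun j k => (b j).elim ((1 : Matrix (Fin d) (Fin d) ℝ) j k) fun i => X i k

/-- The quantity that every pivot step increases: lexicographically, the number of columns with a
pivot and the volume of the basis. -/
noncomputable def basisPotential (X : Matrix (Fin n) (Fin d) ℝ) (b : Fin d → Option (Fin n)) :
    ℕ ×ₗ ℝ :=
  toLex ((Finset.univ.filter fun j => (b j).isSome).card, |(basisMatrix X b).det|)

/-- The number of bases of higher potential; it bounds the number of pivot steps to come. -/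
noncomputable def basisRank (X : Matrix (Fin n) (Fin d) ℝ) (b : Fin d → Option (Fin n)) : ℕ :=
  (Finset.univ.filter fun b' => basisPotential X b < basisPotential X b').card

theorem basisRank_le (X : Matrix (Fin n) (Fin d) ℝ) (b : Fin d → Option (Fin n)) :
    basisRank X b ≤ (n + 1) ^ d := by
  refine (Finset.card_le_univ _).trans ?_
  simp

theorem basisRank_lt {X : Matrix (Fin n) (Fin d) ℝ} {b b' : Fin d → Option (Fin n)}
    (h : basisPotential X b < basisPotential X b') : basisRank X b' < basisRank X b := by
  refine Finset.card_lt_card ?_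
  rw [Finset.ssubset_iff_of_subset]
  · exact ⟨b', by simpa using h, by simp⟩
  · intro c hc
    simp only [Finset.mem_filter, Finset.mem_univ, true_and] at hc ⊢
    exact h.trans hc

theorem basisMatrix_none (X : Matrix (Fin n) (Fin d) ℝ) : basisMatrix X (fun _ => none) = 1 := by
  ext i j
  simp [basisMatrix]

theorem basisMatrix_update (X : Matrix (Fin n) (Fin d) ℝ) (b : Fin d → Option (Fin n))
    (p : Fin n) (q : Fin d) :
    basisMatrix X (Function.update b q (some p)) =
      (basisMatrix X b).updateRow q fun k => X p k := by
  ext j k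
  by_cases h : j = q
  · subst h; simp [basisMatrix]
  · simp [basisMatrix, h]

/-- The effect of the column operation of a pivot step at `(p, q)` on a transformation `T`, if `a`
is row `p` before the step. -/
noncomputable def pivotTransform (T : Matrix (Fin d) (Fin d) ℝ) (a : Fin d → ℝ) (q : Fin d) :
    Matrix (Fin d) (Fin d) ℝ :=
  Matrix.of fun i j => T i j - T i q / a q * (a j - if j = q then 1 else 0)

theorem mul_pivotTransform_apply {m : Type*} (Y : Matrix m (Fin d) ℝ)
    (T : Matrix (Fin d) (Fin d) ℝ) (a : Fin d → ℝ) (q : Fin d) (i : m) (j : Fin d) :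
    (Y * pivotTransform T a q) i j =
      (Y * T) i j - (Y * T) i q / a q * (a j - if j = q then 1 else 0) := by
  simp only [Matrix.mul_apply, pivotTransform, Matrix.of_apply, mul_sub (Y i _),
    Finset.sum_sub_distrib, Finset.sum_div, Finset.sum_mul]
  congr 1
  exact Finset.sum_congr rfl fun k _ => by ring

/-- A pivot step keeps the transformation `T` inverse to the matrix of the basis. -/
theorem basisMatrix_mul_pivotTransform {X : Matrix (Fin n) (Fin d) ℝ}
    {b : Fin d → Option (Fin n)} {T : Matrix (Fin d) (Fin d) ℝ} (hT : basisMatrix X b * T = 1)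
    {p : Fin n} {q : Fin d} (h : (X * T) p q ≠ 0) :
    basisMatrix X (Function.update b q (some p)) *
      pivotTransform T (fun k => (X * T) p k) q = 1 := by
  ext j k
  rw [mul_pivotTransform_apply, basisMatrix_update]
  have key : (basisMatrix X b).updateRow q (fun k => X p k) * T =
      (1 : Matrix (Fin d) (Fin d) ℝ).updateRow q fun k => (X * T) p k := by
    rw [← hT, Matrix.updateRow_mul]
    rfl
  rw [key]
  by_cases hj : j = q
  · subst hj
    simp [h, Matrix.one_apply, eq_comm]
  · simp [hj]

/-- Exchanging the basis vector `q` for the point `p` multiplies the volume of the basis by the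
absolute value of entry `(p, q)`, as follows from Cramer's rule in the coordinates of the basis. -/
theorem abs_det_basisMatrix_update {X : Matrix (Fin n) (Fin d) ℝ}
    {b : Fin d → Option (Fin n)} {T : Matrix (Fin d) (Fin d) ℝ} (hT : basisMatrix X b * T = 1)
    (p : Fin n) (q : Fin d) :
    |(basisMatrix X (Function.update b q (some p))).det| =
      |(X * T) p q| * |(basisMatrix X b).det| := by
  have key : (basisMatrix X b).updateRow q (fun k => X p k) * T =
      (1 : Matrix (Fin d) (Fin d) ℝ).updateRow q fun k => (X * T) p k := by
    rw [← hT, Matrix.updateRow_mul]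
    rfl
  have h1 := congrArg Matrix.det key
  have h3 := Matrix.cramer_transpose_apply (1 : Matrix (Fin d) (Fin d) ℝ)
    (fun k => (X * T) p k) q
  rw [Matrix.transpose_one, Matrix.cramer_one] at h3
  rw [Matrix.det_mul, ← h3] at h1
  have h2 := congrArg Matrix.det hT
  rw [Matrix.det_mul, Matrix.det_one] at h2
  rw [basisMatrix_update, ← abs_mul]
  change _ = (X * T) p q at h1
  rw [← h1, mul_assoc, mul_comm T.det, h2, mul_one]

theorem basisPotential_lt_update {X : Matrix (Fin n) (Fin d) ℝ}
    {b : Fin d → Option (Fin n)} {T : Matrix (Fin d) (Fin d) ℝ} (hT : basisMatrix X b * T = 1)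
    {p : Fin n} {q : Fin d} (h : b q = none ∨ 1 < |(X * T) p q|) :
    basisPotential X b < basisPotential X (Function.update b q (some p)) := by
  rw [basisPotential, basisPotential, Prod.Lex.toLex_lt_toLex]
  have hsub : (Finset.univ.filter fun j => (b j).isSome) ⊆
      Finset.univ.filter fun j => (Function.update b q (some p) j).isSome := by
    intro j hj
    simp only [Finset.mem_filter, Finset.mem_univ, true_and] at hj ⊢
    by_cases hjq : j = q
    · subst hjq; simp
    · simpa [hjq] using hj
  have hle := Finset.card_le_card hsub
  dsimp only
  by_cases hq : b q = none
  · left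
    refine Finset.card_lt_card ((Finset.ssubset_iff_of_subset hsub).2 ⟨q, ?_, ?_⟩) <;> simp [hq]
  · rcases hle.lt_or_eq with hlt | heq
    · exact .inl hlt
    · refine .inr ⟨heq, ?_⟩
      rw [abs_det_basisMatrix_update hT]
      have hdet : (basisMatrix X b).det ≠ 0 := by
        intro h0
        have := congrArg Matrix.det hT
        rw [Matrix.det_mul, h0, zero_mul, Matrix.det_one] at this
        exact zero_ne_one this
      exact lt_mul_of_one_lt_left (abs_pos.2 hdet) (h.resolve_left hq)

/-- No data point occurs twice in a basis. -/
theorem basis_injective {X : Matrix (Fin n) (Fin d) ℝ}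
    {b : Fin d → Option (Fin n)} {T : Matrix (Fin d) (Fin d) ℝ} (hT : basisMatrix X b * T = 1)
    {j k : Fin d} {i : Fin n} (hj : b j = some i) (hk : b k = some i) : j = k := by
  by_contra hne
  have h1 : (basisMatrix X b * T) j j = (basisMatrix X b * T) k j := by
    simp [Matrix.mul_apply, basisMatrix, hj, hk]
  rw [hT, Matrix.one_apply_eq, Matrix.one_apply_ne (Ne.symm hne)] at h1
  exact one_ne_zero h1

theorem card_basis_le {X : Matrix (Fin n) (Fin d) ℝ}
    {b : Fin d → Option (Fin n)} {T : Matrix (Fin d) (Fin d) ℝ} (hT : basisMatrix X b * T = 1) :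
    (Finset.univ.filter fun j => (b j).isSome).card ≤ n := by
  have : Finset.card (Finset.univ.filter fun j => (b j).isSome) ≤
      (Finset.univ.image (some : Fin n → Option (Fin n))).card := by
    refine Finset.card_le_card_of_injOn b ?_ ?_
    · intro j hj
      simp only [Finset.coe_filter, Finset.mem_univ, true_and, Set.mem_ofPred_eq,
        Option.isSome_iff_exists] at hj
      obtain ⟨i, hi⟩ := hj
      simp [hi]
    · intro j hj k hk hjk
      simp only [Finset.coe_filter, Finset.mem_univ, true_and, Set.mem_ofPred_eq,
        Option.isSome_iff_exists] at hj
      obtain ⟨i, hi⟩ := hj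
      exact basis_injective hT hi (hjk ▸ hi)
  exact this.trans (Finset.card_image_le.trans (by simp))

end Basis

namespace RealRAM

/-- Change the basis until no pivot is possible. -/
def findBasis : Program :=
  .seq initTransform (.seq searchPivot
    (.loop (.natLT (.const 0) (natVar 3)) (.seq pivot searchPivot)))

/-- The state holds the matrix `X * T`, the transformation `T`, and the marks of the columns
with a pivot. -/
structure HoldsBasis (s : State) {n d : ℕ} (X : Matrix (Fin n) (Fin d) ℝ)
    (b : Fin d → Option (Fin n)) (T : Matrix (Fin d) (Fin d) ℝ) : Prop where
  mul_eq_one : basisMatrix X b * T = 1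
  points : ∀ (i : Fin n) (j : Fin d), s.real 0 i j = (X * T) i j
  transform : ∀ i j : Fin d, s.real 4 i j = T i j
  marks : ∀ j : Fin d, s.nat 2 j 0 = if (b j).isSome then 1 else 0

theorem halts_findBasis (s : State) {n d : ℕ} (X : Matrix (Fin n) (Fin d) ℝ)
    (hn : s.nat 0 0 0 = n) (hd : s.nat 0 0 1 = d)
    (hX : ∀ (i : Fin n) (j : Fin d), s.real 0 i j = X i j)
    (h4 : ∀ i j, s.real 4 i j = 0) (h2 : ∀ j, s.nat 2 j 0 = 0) :
    Halts findBasis s (1000 * ((n + 2) ^ 2 * (d + 1) ^ 2 * (n + 1) ^ d)) fun s' =>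
      ∃ b T, HoldsBasis s' X b T ∧ (∀ i j, b j = none → (X * T) i j = 0) ∧
        ∀ i j, |(X * T) i j| ≤ 1 := by
  refine ((halts_initTransform s hd).seq fun s₁ hF₁ h₁ =>
    (halts_searchPivot s₁ (n := n) (d := d) (by rw [hF₁.nat 0 (by decide), hn])
      (by rw [hF₁.nat 0 (by decide), hd])).seq
    (T' := ((n + 1) ^ d + 1) * ((((d + 1) * 44 + (20 + (20 + ((n + 1) * (20 + (d + 1) * 70 + 32) +
      ((d + 1) * (20 + (d + 1) * 70 + 32) + 20))))) + (20 + (n + 1) * ((d + 1) * 110 + 32))) +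
        5 + 1))
    fun s₂ hF₂ h₂ => ?_).time ?_
  · have hB₂ : HoldsBasis s₂ X (fun _ => none) 1 := by
      refine ⟨by rw [basisMatrix_none, one_mul], ?_, ?_, ?_⟩
      · intro i j
        rw [show X * (1 : Matrix (Fin d) (Fin d) ℝ) = X from Matrix.mul_one X,
          hF₂.real 0 (by decide), hF₁.real 0 (by decide), hX]
      · intro i j
        rw [hF₂.real 4 (by decide), h₁, h4, Matrix.one_apply]
        simp [Fin.ext_iff]
      · intro j
        rw [hF₂.nat 2 (by decide), hF₁.nat 2 (by decide), h2]
        simp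
    have e₂ : s₂.nat 0 = s.nat 0 := by rw [hF₂.nat 0 (by decide), hF₁.nat 0 (by decide)]
    refine (Halts.loop (b := .natLT (.const 0) (natVar 3)) (fun v s' => ∃ b T,
      HoldsBasis s' X b T ∧ basisRank X b ≤ v ∧ SearchResult s' n d fun i j => i < n ∧ j < d)
      ⟨_, _, hB₂, basisRank_le _ _, h₂⟩ ?_).weaken ?_
    · rintro v s₃ hF₃ ⟨b, T, hB, hv, hS⟩ hb
      have hb' : s₃.nat 3 0 0 ≠ 0 := Nat.pos_iff_ne_zero.1 hb
      obtain ⟨hp, hq, hpq⟩ := hS.2 hb'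
      have e₃ : s₃.nat 0 = s.nat 0 := by rw [hF₃.nat 0 (by decide), e₂]
      refine (halts_pivot s₃ (by rw [e₃, hn]) (by rw [e₃, hd]) rfl rfl hq).seq
        fun s₄ hF₄ h₄ => ?_
      have e₄ : s₄.nat 0 = s.nat 0 := by rw [hF₄.nat 0 (by decide), e₃]
      refine (halts_searchPivot s₄ (by rw [e₄, hn]) (by rw [e₄, hd])).weaken fun s₅ hF₅ h₅ => ?_
      set p : Fin n := ⟨s₃.nat 4 0 0, hp⟩ with hp_def
      set q : Fin d := ⟨s₃.nat 5 0 0, hq⟩ with hq_def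
      have hApq : s₃.real 0 (s₃.nat 4 0 0) (s₃.nat 5 0 0) = (X * T) p q := hB.points p q
      simp only [CanPivot, hApq] at hpq
      have hne : (X * T) p q ≠ 0 := by
        intro h0
        rw [h0] at hpq
        norm_num at hpq
      have hor : b q = none ∨ 1 < |(X * T) p q| := by
        rcases hpq with ⟨-, hm⟩ | h
        · left
          have := hB.marks q
          rw [show s₃.nat 2 (q : ℕ) 0 = 0 by simpa using hm] at this
          simpa using this
        · right
          rw [← abs_mul_abs_self] at h
          by_contra hle
          rw [not_lt] at hle
          nlinarith [abs_nonneg ((X * T) p q)]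
      refine ⟨_, lt_of_lt_of_le (basisRank_lt (basisPotential_lt_update hB.mul_eq_one hor)) hv,
        Function.update b q (some p), pivotTransform T (fun k => (X * T) p k) q, ?_, le_rfl, h₅⟩
      refine ⟨basisMatrix_mul_pivotTransform hB.mul_eq_one hne, ?_, ?_, ?_⟩
      · intro i j
        have e1 := hB.points i q
        have e2 := hB.points p j
        simp only [hp_def, hq_def] at e1 e2
        rw [hF₅.real 0 (by decide), h₄.1 i j i.2 j.2, mul_pivotTransform_apply, hApq,
          hB.points, e1, e2]
        simp only [Fin.ext_iff, hq_def, hp_def]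
      · intro i j
        have e1 := hB.transform i q
        have e2 := hB.points p j
        simp only [hp_def, hq_def] at e1 e2
        rw [hF₅.real 4 (by decide), h₄.2.1 i j i.2 j.2, hApq, hB.transform, e1, e2]
        simp only [pivotTransform, Matrix.of_apply, Fin.ext_iff, hq_def, hp_def]
      · intro j
        rw [hF₅.nat 2 (by decide), h₄.2.2, hB.marks]
        by_cases hj : j = q
        · subst hj
          simp [hq_def]
        · have : (j : ℕ) ≠ s₃.nat 5 0 0 := fun h => hj (Fin.ext h)
          simp [hj, this]
    · rintro s₃ - ⟨hb, v, b, T, hB, -, hS⟩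
      refine ⟨b, T, hB, ?_⟩
      have h3 : s₃.nat 3 0 0 = 0 := by simpa [Test.Holds, NExpr.eval] using hb
      have hno : ∀ (i : Fin n) (j : Fin d), ¬ CanPivot s₃ i j :=
        fun i j => hS.1 h3 i j ⟨i.2, j.2⟩
      simp only [CanPivot, hB.points, hB.marks] at hno
      refine ⟨fun i j hj => ?_, fun i j => ?_⟩
      · have := hno i j
        rw [hj] at this
        by_contra hne
        exact this (.inl ⟨mul_self_pos.2 hne, by simp⟩)
      · have := not_lt.1 fun h => hno i j (.inr h)
        exact abs_le_one_iff_mul_self_le_one.2 this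
  · have hG : 1 ≤ (n + 1) ^ d := Nat.one_le_pow _ _ (by omega)
    generalize (n + 1) ^ d = G at hG
    obtain ⟨G, rfl⟩ := Nat.exists_eq_add_of_le hG
    ring_nf
    nlinarith [Nat.zero_le (n * d), Nat.zero_le (n * d * G), Nat.zero_le (n * d ^ 2),
      Nat.zero_le (n * d ^ 2 * G)]

end RealRAM

/-! ### Optimal permutations by sorting -/

section Sorting

/-- The element `j` comes before `i` when `0, 1, …` are sorted by the values of `f`, and by index
in case of a tie. -/
def Precedes (f : ℕ → ℝ) (j i : ℕ) : Prop := f j < f i ∨ ¬ f i < f j ∧ j < i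

/-- The position of `i` when `0, …, n - 1` are sorted by the values of `f`. -/
noncomputable def sortRank (f : ℕ → ℝ) (n i : ℕ) : ℕ := by
  classical exact ((Finset.range n).filter fun j => Precedes f j i).card

theorem Precedes.irrefl (f : ℕ → ℝ) (i : ℕ) : ¬ Precedes f i i := by
  simp [Precedes]

theorem Precedes.trans {f : ℕ → ℝ} {i j k : ℕ} (h : Precedes f i j) (h' : Precedes f j k) :
    Precedes f i k := by
  simp only [Precedes, not_lt] at *
  rcases h with h | ⟨h, h1⟩ <;> rcases h' with h' | ⟨h', h1'⟩
  · exact .inl (h.trans h')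
  · exact .inl (h.trans_le h')
  · exact .inl (h.trans_lt h')
  · exact .inr ⟨h.trans h', h1.trans h1'⟩

theorem Precedes.total (f : ℕ → ℝ) {i j : ℕ} (h : i ≠ j) : Precedes f i j ∨ Precedes f j i := by
  simp only [Precedes, not_lt]
  rcases lt_trichotomy (f i) (f j) with h1 | h1 | h1
  · exact .inl (.inl h1)
  · rcases h.lt_or_gt with h2 | h2
    · exact .inl (.inr ⟨h1.le, h2⟩)
    · exact .inr (.inr ⟨h1.ge, h2⟩)
  · exact .inr (.inl h1)

theorem sortRank_lt_sortRank {f : ℕ → ℝ} {n i j : ℕ} (hi : i < n) (h : Precedes f i j) :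
    sortRank f n i < sortRank f n j := by
  classical
  refine Finset.card_lt_card ((Finset.ssubset_iff_of_subset ?_).2 ⟨i, ?_, ?_⟩)
  · intro k hk
    simp only [Finset.mem_filter] at hk ⊢
    exact ⟨hk.1, hk.2.trans h⟩
  · simp [hi, h]
  · simp [Precedes.irrefl]

theorem sortRank_lt {f : ℕ → ℝ} {n i : ℕ} (hi : i < n) : sortRank f n i < n := by
  classical
  conv_rhs => rw [← Finset.card_range n]
  refine Finset.card_lt_card ((Finset.ssubset_iff_of_subset (Finset.filter_subset _ _)).2
    ⟨i, by simpa using hi, by simp [Precedes.irrefl]⟩)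

/-- The permutation that sends each index to its position in the sorted order. -/
noncomputable def sortPerm (f : ℕ → ℝ) (n : ℕ) : Equiv.Perm (Fin n) :=
  Equiv.ofBijective (fun i => ⟨sortRank f n i, sortRank_lt i.2⟩) <| by
    refine Finite.injective_iff_bijective.1 fun i j hij => ?_
    by_contra hne
    have h : sortRank f n i = sortRank f n j := congrArg Fin.val hij
    rcases Precedes.total f (fun h => hne (Fin.ext h) : (i : ℕ) ≠ j) with h1 | h1
    · exact (sortRank_lt_sortRank i.2 h1).ne h
    · exact (sortRank_lt_sortRank j.2 h1).ne' h

@[simp]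
theorem sortPerm_val (f : ℕ → ℝ) {n : ℕ} (i : Fin n) : (sortPerm f n i : ℕ) = sortRank f n i :=
  rfl

/-- The permutation that matches the sorted order of `g` with the sorted order of `f`. -/
noncomputable def matchPerm (f g : ℕ → ℝ) (n : ℕ) : Equiv.Perm (Fin n) :=
  (sortPerm g n).trans (sortPerm f n).symm

theorem sortRank_matchPerm (f g : ℕ → ℝ) {n : ℕ} (i : Fin n) :
    sortRank f n (matchPerm f g n i) = sortRank g n i := by
  rw [← sortPerm_val, ← sortPerm_val]
  simp [matchPerm]

theorem monovary_matchPerm (f g : ℕ → ℝ) (n : ℕ) :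
    Monovary (fun i : Fin n => f (matchPerm f g n i)) fun i : Fin n => g i := by
  intro i j hij
  dsimp only
  by_contra hlt
  rw [not_le] at hlt
  have h1 := sortRank_lt_sortRank i.2 (show Precedes g i j from .inl hij)
  have h2 := sortRank_lt_sortRank (f := f) (matchPerm f g n j).2 (.inl hlt)
  rw [sortRank_matchPerm, sortRank_matchPerm] at h2
  exact absurd h1 h2.not_gt

/-- Matching in sorted order minimizes the sum of squared differences. -/
theorem sum_sq_matchPerm_le (f g : ℕ → ℝ) (n : ℕ) (σ : Equiv.Perm (Fin n)) :
    ∑ i : Fin n, (f (matchPerm f g n i) - g i) ^ 2 ≤ ∑ i : Fin n, (f (σ i) - g i) ^ 2 := by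
  have h := (monovary_matchPerm f g n).sum_comp_perm_mul_le_sum_mul
    (σ := σ.trans (matchPerm f g n).symm)
  simp only [Equiv.trans_apply, Equiv.apply_symm_apply] at h
  have e : ∀ τ : Equiv.Perm (Fin n), ∑ i : Fin n, (f (τ i) - g i) ^ 2 =
      ∑ i : Fin n, f i ^ 2 - 2 * ∑ i : Fin n, f (τ i) * g i + ∑ i : Fin n, g i ^ 2 := by
    intro τ
    rw [← Equiv.sum_comp τ fun i : Fin n => f i ^ 2, Finset.mul_sum, ← Finset.sum_sub_distrib,
      ← Finset.sum_add_distrib]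
    exact Finset.sum_congr rfl fun i _ => by ring
  rw [e, e]
  linarith

end Sorting

namespace RealRAM

/-- Real array `11` becomes the vector of the candidates selected by the digits in natural
array `11`. -/
def lookup : Program :=
  forLoop 7 dimD (setRealAt 11 (natVar 7) (realAt 10 (natAt 11 (natVar 7))))

theorem halts_lookup (s : State) {d : ℕ} (hd : s.nat 0 0 1 = d) :
    Halts lookup s ((d + 1) * 52) fun s' =>
      ∀ j < d, s'.real 11 j 0 = s.real 10 (s.nat 11 j 0) 0 := by
  refine Halts.forLoop (T := 20)
    (fun k s' => ∀ j < k, s'.real 11 j 0 = s.real 10 (s.nat 11 j 0) 0)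
    (by decide) (by decide) ?_ ?_ ?_
  · intro s' hF
    simp [NExpr.eval, hF.nat 0 (by decide), hd]
  · simp
  · intro k hk s' hF hk' hI
    refine Halts.setReal ?_
    intro j hj
    by_cases hjk : j = k
    · simp [NExpr.eval, RExpr.eval, State.writeNat, State.writeReal, hk', hjk,
        hF.nat 11 (by decide), hF.real 10 (by decide)]
    · simpa [NExpr.eval, RExpr.eval, State.writeNat, State.writeReal, hk', hjk] using
        hI j (by omega)

/-- Real array `c` becomes the product of the matrix in real array `a`, with `e` rows and `d`
columns, and the vector in real array `b`. -/
def matVec (c a b : ℕ) (e : NExpr) : Program :=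
  forLoop 6 e (.seq (setRealAt c (natVar 6) (.const 0))
    (forLoop 7 dimD (setRealAt c (natVar 6) (.add (realAt c (natVar 6))
      (.mul (.get a (natVar 6) (natVar 7)) (realAt b (natVar 7)))))))

theorem halts_matVec (s : State) {c a b : ℕ} {e : NExpr} {n d : ℕ} (ha : a ≠ c) (hb : b ≠ c)
    (hc : e.cost ≤ 15) (he : ∀ s', s'.nat 0 = s.nat 0 → e.eval s' = n) (hd : s.nat 0 0 1 = d) :
    Halts (matVec c a b e) s ((n + 1) * (20 + (d + 1) * 72 + 32)) fun s' =>
      ∀ i < n, s'.real c i 0 = ∑ j ∈ Finset.range d, s.real a i j * s.real b j 0 := by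
  refine Halts.forLoop
    (fun k s' => ∀ i < k, s'.real c i 0 = ∑ j ∈ Finset.range d, s.real a i j * s.real b j 0)
    (by simp [Program.natTargets, forLoop]) hc ?_ ?_ ?_
  · intro s' hF
    exact he s' (hF.nat 0 (by simp [Program.natTargets, forLoop]))
  · simp
  · intro k hk s₁ hF₁ hk₁ hI₁
    refine Halts.seq_left (Halts.setReal ?_)
    refine (Halts.forLoop (N := d) (T := 40) (fun l s' => (∀ i < k, s'.real c i 0 =
        ∑ j ∈ Finset.range d, s.real a i j * s.real b j 0) ∧
        s'.real c k 0 = ∑ j ∈ Finset.range l, s.real a k j * s.real b j 0)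
      (by simp [Program.natTargets]) (by decide) ?_ ?_ ?_).weaken ?_
    · intro s' hF
      simp [NExpr.eval, hF.nat 0 (by simp [Program.natTargets, forLoop]), State.writeReal,
        hF₁.nat 0 (by simp [Program.natTargets, forLoop]), hd]
    · refine ⟨fun i hi => ?_, ?_⟩
      · simpa [State.writeNat, State.writeReal, NExpr.eval, hk₁, hi.ne] using hI₁ i hi
      · simp [State.writeNat, State.writeReal, NExpr.eval, RExpr.eval, hk₁]
    · intro l hl s₂ hF₂ hl₂ hI₂
      have hk₂ : s₂.nat 6 0 0 = k := by
        rw [hF₂.nat 6 (by simp [Program.natTargets, forLoop])]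
        simpa [State.writeReal] using hk₁
      have h0 : s₂.real a = s.real a := by
        rw [hF₂.real a (by simp [Program.realTargets, forLoop, ha]),
          ← hF₁.real a (by simp [Program.realTargets, forLoop, ha])]
        simp [State.writeReal, ha]
      have h11 : s₂.real b = s.real b := by
        rw [hF₂.real b (by simp [Program.realTargets, forLoop, hb]),
          ← hF₁.real b (by simp [Program.realTargets, forLoop, hb])]
        simp [State.writeReal, hb]
      refine Halts.setReal ⟨fun i hi => ?_, ?_⟩
      · simpa [State.writeNat, State.writeReal, NExpr.eval, hk₂, hi.ne] using hI₂.1 i hi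
      · simp [State.writeNat, State.writeReal, NExpr.eval, RExpr.eval, hk₂, hl₂, h0, h11, hI₂.2,
          Finset.sum_range_succ]
    · intro s₂ hF₂ hI₂ i hi
      rcases Nat.lt_succ_iff_lt_or_eq.1 hi with hi | rfl
      · exact hI₂.1 i hi
      · exact hI₂.2

/-- The test for `Precedes`, for column `0` of the real array `a`, at the indices in variables `7`
and `6`. -/
def precedesTest (a : ℕ) : Test :=
  .not (.and (.not (.realLT (realAt a (natVar 7)) (realAt a (natVar 6))))
    (.not (.and (.not (.realLT (realAt a (natVar 6)) (realAt a (natVar 7))))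
      (.natLT (natVar 7) (natVar 6)))))

theorem holds_precedesTest (a : ℕ) (s : State) :
    (precedesTest a).Holds s ↔ Precedes (fun i => s.real a i 0) (s.nat 7 0 0) (s.nat 6 0 0) := by
  simp only [precedesTest, Test.Holds, Precedes, NExpr.eval, RExpr.eval]
  tauto

/-- Natural array `b` becomes the list of positions in the sorted order of real array `a`. -/
def rank (a b : ℕ) : Program :=
  forLoop 6 dimN (.seq (setNatAt b (natVar 6) (.const 0))
    (forLoop 7 dimN (.branch (precedesTest a)
      (setNatAt b (natVar 6) (.add (natAt b (natVar 6)) (.const 1))) .skip)))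

theorem halts_rank (s : State) {n a b : ℕ} (hb : 8 ≤ b) (hn : s.nat 0 0 0 = n) :
    Halts (rank a b) s ((n + 1) * (20 + (n + 1) * 112 + 32)) fun s' =>
      ∀ i < n, s'.nat b i 0 = sortRank (fun i => s.real a i 0) n i := by
  classical
  have hb6 : 6 ≠ b := by omega
  have hb7 : 7 ≠ b := by omega
  have hb0 : 0 ≠ b := by omega
  refine Halts.forLoop
    (fun k s' => ∀ i < k, s'.nat b i 0 = sortRank (fun i => s.real a i 0) n i)
    (by simp [Program.natTargets, forLoop, hb6]) (by decide) ?_ ?_ ?_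
  · intro s' hF
    have := hF.nat 0 (by simp [Program.natTargets, forLoop, hb0])
    simp [NExpr.eval, this, hn]
  · simp
  · intro k hk s₁ hF₁ hk₁ hI₁
    have h1 := hF₁.nat 0 (by simp [Program.natTargets, forLoop, hb0])
    have ha1 := hF₁.real a (by simp [Program.realTargets, forLoop])
    refine Halts.seq_left (Halts.setNat ?_)
    refine (Halts.forLoop (N := n) (T := 80) (fun l s' => (∀ i < k, s'.nat b i 0 =
        sortRank (fun i => s.real a i 0) n i) ∧
        s'.nat b k 0 = ((Finset.range l).filter
          fun j => Precedes (fun i => s.real a i 0) j k).card)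
      (by simp [Program.natTargets, hb7]) (by decide) ?_ ?_ ?_).weaken ?_
    · intro s' hF
      have := hF.nat 0 (by simp [Program.natTargets, forLoop, hb0])
      simp [NExpr.eval, this, State.writeNat, h1, hn, hb0]
    · refine ⟨fun i hi => ?_, ?_⟩
      · simpa [State.writeNat, NExpr.eval, hk₁, hi.ne, hb7.symm] using hI₁ i hi
      · simp [State.writeNat, NExpr.eval, hk₁, hb7.symm]
    · intro l hl s₂ hF₂ hl₂ hI₂
      have hk₂ : s₂.nat 6 0 0 = k := by
        rw [hF₂.nat 6 (by simp [Program.natTargets, forLoop, hb6])]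
        simpa [State.writeNat, hb6] using hk₁
      have ha : s₂.real a = s.real a := by
        rw [hF₂.real a (by simp [Program.realTargets, forLoop]), ← ha1]
        simp [State.writeNat]
      refine Halts.branch (T := 20) ?_ ?_
        (by simp [precedesTest, Test.cost, NExpr.cost, RExpr.cost])
      · intro h
        rw [holds_precedesTest, hk₂, hl₂, ha] at h
        refine Halts.setNat ⟨fun i hi => ?_, ?_⟩
        · simpa [State.writeNat, NExpr.eval, hk₂, hi.ne, hb7.symm] using hI₂.1 i hi
        · simp [State.writeNat, NExpr.eval, hk₂, hb7.symm, hI₂.2, Finset.range_add_one,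
            Finset.filter_insert, h]
      · intro h
        rw [holds_precedesTest, hk₂, hl₂, ha] at h
        refine Halts.skip ⟨fun i hi => ?_, ?_⟩
        · simpa [State.writeNat, NExpr.eval, hk₂, hi.ne, hb7.symm] using hI₂.1 i hi
        · simp [State.writeNat, hb7.symm, hI₂.2, Finset.range_add_one,
            Finset.filter_insert, h]
    · intro s₂ hF₂ hI₂ i hi
      have : (s₂.writeNat 6 0 0 (k + 1)).nat b i 0 = s₂.nat b i 0 := by
        simp [State.writeNat, hb6.symm]
      rw [this]
      rcases Nat.lt_succ_iff_lt_or_eq.1 hi with hi | rfl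
      · exact hI₂.1 i hi
      · rw [hI₂.2, sortRank]

/-- Natural array `15` becomes the permutation that matches the positions in natural array `13` with
the positions in natural array `12`. -/
def matchRanks : Program :=
  .seq (forLoop 6 dimN (setNatAt 14 (natAt 12 (natVar 6)) (natVar 6)))
    (forLoop 6 dimN (setNatAt 15 (natVar 6) (natAt 14 (natAt 13 (natVar 6)))))

theorem halts_matchRanks (s : State) {n : ℕ} {f g : ℕ → ℝ} (hn : s.nat 0 0 0 = n)
    (hf : ∀ i < n, s.nat 12 i 0 = sortRank f n i) (hg : ∀ i < n, s.nat 13 i 0 = sortRank g n i) :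
    Halts matchRanks s ((n + 1) * 52 + (n + 1) * 52) fun s' =>
      ∀ i : Fin n, s'.nat 15 i 0 = matchPerm f g n i := by
  have h1 : Halts (forLoop 6 dimN (setNatAt 14 (natAt 12 (natVar 6)) (natVar 6))) s
      ((n + 1) * 52) fun s' => ∀ i < n, s'.nat 14 (sortRank f n i) 0 = i := by
    refine Halts.forLoop (T := 20) (fun k s' => ∀ i < k, s'.nat 14 (sortRank f n i) 0 = i)
      (by decide) (by decide) ?_ ?_ ?_
    · intro s' hF
      simp [NExpr.eval, hF.nat 0 (by decide), hn]
    · simp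
    · intro k hk s' hF hk' hI
      refine Halts.setNat ?_
      intro i hi
      have h12 : s'.nat 12 k 0 = sortRank f n k := by rw [hF.nat 12 (by decide), hf k hk]
      by_cases hik : i = k
      · simp [NExpr.eval, State.writeNat, hk', hik, h12]
      · have hne : sortRank f n i ≠ sortRank f n k := by
          rcases Precedes.total f hik with h | h
          · exact (sortRank_lt_sortRank (by omega) h).ne
          · exact (sortRank_lt_sortRank hk h).ne'
        simpa [NExpr.eval, State.writeNat, hk', h12, hne] using hI i (by omega)
  refine h1.seq fun s₁ hF₁ h₁ => ?_
  refine (Halts.forLoop (N := n) (T := 20)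
    (fun k s' => ∀ i : Fin n, (i : ℕ) < k → s'.nat 15 i 0 = matchPerm f g n i)
      (by decide) (by decide) ?_ ?_ ?_).weaken fun s' _ h i => h i i.2
  · intro s' hF
    simp [NExpr.eval, hF.nat 0 (by decide), hF₁.nat 0 (by decide), hn]
  · simp
  · intro k hk s' hF hk' hI
    refine Halts.setNat ?_
    intro i hi
    by_cases hik : (i : ℕ) = k
    · have e : s'.nat 14 (sortRank g n k) 0 = matchPerm f g n i := by
        rw [hF.nat 14 (by decide), ← hik, ← sortRank_matchPerm f g i, h₁ _ (matchPerm f g n i).2]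
      simp [NExpr.eval, State.writeNat, hk', hik, hF.nat 13 (by decide), hF₁.nat 13 (by decide),
        hg k hk, e]
    · simpa [NExpr.eval, State.writeNat, hk', hik] using hI i (by omega)

/-- Real variables `13` and `14` become the sums of the squares and of the absolute values of the
residuals. -/
def score : Program :=
  .seq (setRealVar 13 (.const 0)) (.seq (setRealVar 14 (.const 0))
    (forLoop 6 dimN (.seq
      (setRealVar 7 (.sub (realAt 12 (natAt 15 (natVar 6))) (realAt 1 (natVar 6))))
      (.seq (setRealVar 13 (.add (realVar 13) (.mul (realVar 7) (realVar 7))))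
        (.branch (.realLT (.const 0) (realVar 7))
          (setRealVar 14 (.add (realVar 14) (realVar 7)))
          (setRealVar 14 (.sub (realVar 14) (realVar 7))))))))

theorem halts_score (s : State) {n : ℕ} (hn : s.nat 0 0 0 = n) :
    Halts score s (20 + (20 + (n + 1) * (20 + (20 + (20 + 60)) + 32))) fun s' =>
      s'.real 13 0 0 = ∑ i ∈ Finset.range n, (s.real 12 (s.nat 15 i 0) 0 - s.real 1 i 0) ^ 2 ∧
      s'.real 14 0 0 = ∑ i ∈ Finset.range n, |s.real 12 (s.nat 15 i 0) 0 - s.real 1 i 0| := by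
  refine Halts.seq_left (Halts.setReal ?_)
  refine Halts.seq_left (Halts.setReal ?_)
  refine Halts.forLoop (T := 20 + (20 + (20 + 60))) (fun k s' =>
      s'.real 13 0 0 = ∑ i ∈ Finset.range k, (s.real 12 (s.nat 15 i 0) 0 - s.real 1 i 0) ^ 2 ∧
      s'.real 14 0 0 = ∑ i ∈ Finset.range k, |s.real 12 (s.nat 15 i 0) 0 - s.real 1 i 0|)
    (by decide) (by decide) ?_ ?_ ?_
  · intro s' hF
    simp [NExpr.eval, hF.nat 0 (by decide), State.writeReal, hn]
  · simp [State.writeNat, State.writeReal, NExpr.eval, RExpr.eval]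
  · intro k hk s₁ hF₁ hk₁ hI₁
    have h12 : s₁.real 12 = s.real 12 := by
      rw [hF₁.real 12 (by decide)]; simp [State.writeReal]
    have h1 : s₁.real 1 = s.real 1 := by
      rw [hF₁.real 1 (by decide)]; simp [State.writeReal]
    have h15 : s₁.nat 15 = s.nat 15 := hF₁.nat 15 (by decide)
    refine Halts.seq_left (Halts.setReal ?_)
    refine Halts.seq_left (Halts.setReal ?_)
    refine Halts.branch (T := 20) ?_ ?_
    · intro h
      simp only [Test.Holds, State.writeReal, NExpr.eval, RExpr.eval, hk₁, h12, h1, h15] at h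
      refine Halts.setReal ⟨?_, ?_⟩
      · simp [State.writeNat, State.writeReal, NExpr.eval, RExpr.eval, hk₁, h12, h1, h15, hI₁.1,
          Finset.sum_range_succ]
        ring
      · simp [State.writeNat, State.writeReal, NExpr.eval, RExpr.eval, hk₁, h12, h1, h15, hI₁.2,
          Finset.sum_range_succ]
        rw [abs_of_pos]
        simpa using h
    · intro h
      simp only [Test.Holds, State.writeReal, NExpr.eval, RExpr.eval, hk₁, h12, h1, h15] at h
      refine Halts.setReal ⟨?_, ?_⟩
      · simp [State.writeNat, State.writeReal, NExpr.eval, RExpr.eval, hk₁, h12, h1, h15, hI₁.1,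
          Finset.sum_range_succ]
        ring
      · simp [State.writeNat, State.writeReal, NExpr.eval, RExpr.eval, hk₁, h12, h1, h15, hI₁.2,
          Finset.sum_range_succ]
        rw [abs_of_nonpos]
        · ring
        · simpa using h

/-- The arrays with names `o`, `l`, `u` (real) and `p` (natural) describe a candidate: `u` holds the
coefficient vector `v`, `p` holds an optimal permutation for it, `o` holds the objective value and
`l` the sum of the absolute values of the residuals. -/
def HoldsCandidate (s : State) {n d : ℕ} (A : Fin n → Fin d → ℝ) (y : Fin n → ℝ)
    (o l u p : ℕ) (v : Fin d → ℝ) : Prop :=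
  (∀ j : Fin d, s.real u j 0 = v j) ∧ ∃ σ : Equiv.Perm (Fin n),
    (∀ i : Fin n, s.nat p i 0 = σ i) ∧
    s.real o 0 0 = leastSquaresObjective A y v σ ∧
    (∀ τ, leastSquaresObjective A y v σ ≤ leastSquaresObjective A y v τ) ∧
    s.real l 0 0 = ∑ i, |v ⬝ᵥ A (σ i) - y i|

/-- Evaluate the candidate selected by the digits in natural array `11`. -/
def evaluate : Program :=
  .seq lookup (.seq (matVec 12 0 11 dimN)
    (.seq (rank 12 12) (.seq (rank 1 13) (.seq matchRanks score))))

theorem halts_evaluate (s : State) {n d : ℕ} {A : Fin n → Fin d → ℝ} {y : Fin n → ℝ}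
    (hn : s.nat 0 0 0 = n) (hd : s.nat 0 0 1 = d)
    (hA : ∀ (i : Fin n) (j : Fin d), s.real 0 i j = A i j) (hy : ∀ i : Fin n, s.real 1 i 0 = y i) :
    Halts evaluate s (1000 * ((n + 2) ^ 2 * (d + 1))) fun s' =>
      HoldsCandidate s' A y 13 14 11 15 fun j => s.real 10 (s.nat 11 j 0) 0 := by
  refine ((halts_lookup s hd).seq fun s₁ hF₁ h₁ =>
    (halts_matVec s₁ (n := n) (d := d) (by decide) (by decide) (by decide)
      (fun s' h => by simp [NExpr.eval, h, hF₁.nat 0 (by decide), hn])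
      (by rw [hF₁.nat 0 (by decide), hd])).seq fun s₂ hF₂ h₂ =>
    (halts_rank s₂ (n := n) (by decide) (by rw [hF₂.nat 0 (by decide), hF₁.nat 0 (by decide),
      hn])).seq fun s₃ hF₃ h₃ =>
    (halts_rank s₃ (n := n) (by decide) (by rw [hF₃.nat 0 (by decide), hF₂.nat 0 (by decide),
      hF₁.nat 0 (by decide), hn])).seq fun s₄ hF₄ h₄ =>
    (halts_matchRanks s₄ (n := n) (f := fun i => s₂.real 12 i 0) (g := fun i => s.real 1 i 0)
      ?_ ?_ ?_).seq fun s₅ hF₅ h₅ =>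
    (halts_score s₅ (n := n) ?_).weaken fun s₆ hF₆ h₆ => ?_).time ?_
  · rw [hF₄.nat 0 (by decide), hF₃.nat 0 (by decide), hF₂.nat 0 (by decide),
      hF₁.nat 0 (by decide), hn]
  · rw [hF₄.nat 12 (by decide)]
    exact h₃
  · rw [← hF₁.real 1 (by decide), ← hF₂.real 1 (by decide), ← hF₃.real 1 (by decide)]
    exact h₄
  · rw [hF₅.nat 0 (by decide), hF₄.nat 0 (by decide), hF₃.nat 0 (by decide),
      hF₂.nat 0 (by decide), hF₁.nat 0 (by decide), hn]
  · set v : Fin d → ℝ := fun j => s.real 10 (s.nat 11 j 0) 0 with hv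
    have e12 : s₅.real 12 = s₂.real 12 := by
      rw [hF₅.real 12 (by decide), hF₄.real 12 (by decide), hF₃.real 12 (by decide)]
    have e1 : s₅.real 1 = s.real 1 := by
      rw [hF₅.real 1 (by decide), hF₄.real 1 (by decide), hF₃.real 1 (by decide),
        hF₂.real 1 (by decide), hF₁.real 1 (by decide)]
    have hp : ∀ i : Fin n, s₂.real 12 i 0 = v ⬝ᵥ A i := by
      intro i
      rw [h₂ i i.2, Finset.sum_range, dotProduct]
      refine Finset.sum_congr rfl fun j _ => ?_
      rw [h₁ j j.2, hF₁.real 0 (by decide), hA, mul_comm]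
    have hr : ∀ i : Fin n, s₅.real 12 (s₅.nat 15 i 0) 0 - s₅.real 1 i 0 =
        v ⬝ᵥ A (matchPerm (fun i => s₂.real 12 i 0) (fun i => s.real 1 i 0) n i) - y i := by
      intro i
      rw [h₅ i, e12, e1, hp, hy]
    refine ⟨fun j => ?_, matchPerm (fun i => s₂.real 12 i 0) (fun i => s.real 1 i 0) n, ?_, ?_,
      ?_, ?_⟩
    · rw [hF₆.real 11 (by decide), hF₅.real 11 (by decide), hF₄.real 11 (by decide),
        hF₃.real 11 (by decide), hF₂.real 11 (by decide), h₁ j j.2]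
    · rw [hF₆.nat 15 (by decide)]
      exact h₅
    · rw [h₆.1, Finset.sum_range, leastSquaresObjective]
      exact Finset.sum_congr rfl fun i _ => by rw [hr]
    · intro τ
      have := sum_sq_matchPerm_le (fun i => s₂.real 12 i 0) (fun i => s.real 1 i 0) n τ
      simpa only [hp, hy, leastSquaresObjective] using this
    · rw [h₆.2, Finset.sum_range]
      exact Finset.sum_congr rfl fun i _ => by rw [hr]
  · ring_nf
    nlinarith [Nat.zero_le (n * d), Nat.zero_le (n ^ 2 * d)]

end RealRAM

/-! ### Enumeration of coordinate vectors -/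

namespace RealRAM

theorem HoldsCandidate.congr {s s' : State} {n d : ℕ} {A : Fin n → Fin d → ℝ} {y : Fin n → ℝ}
    {o l u p : ℕ} {v : Fin d → ℝ} (h : HoldsCandidate s A y o l u p v)
    (ho : s'.real o = s.real o) (hl : s'.real l = s.real l) (hu : s'.real u = s.real u)
    (hp : s'.nat p = s.nat p) : HoldsCandidate s' A y o l u p v := by
  rw [HoldsCandidate, ho, hl, hu, hp]
  exact h

/-- Either no candidate has been stored and `S` is empty, or the stored candidate has an
objective value that is a lower bound of `S`. Natural variable `16` distinguishes the cases. -/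
def HoldsBest (s : State) {n d : ℕ} (A : Fin n → Fin d → ℝ) (y : Fin n → ℝ) (S : Set ℝ) : Prop :=
  (s.nat 16 0 0 = 0 ∧ S = ∅) ∨
    (s.nat 16 0 0 = 1 ∧ (∃ v, HoldsCandidate s A y 15 16 17 1 v) ∧ ∀ c ∈ S, s.real 15 0 0 ≤ c)

theorem HoldsBest.mono {s : State} {n d : ℕ} {A : Fin n → Fin d → ℝ} {y : Fin n → ℝ}
    {S S' : Set ℝ} (h : HoldsBest s A y S) (hS : S' ⊆ S) : HoldsBest s A y S' := by
  rcases h with ⟨h, rfl⟩ | ⟨h, hv, hc⟩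
  · exact .inl ⟨h, Set.subset_empty_iff.1 hS⟩
  · exact .inr ⟨h, hv, fun c hc' => hc c (hS hc')⟩

theorem HoldsBest.congr {s s' : State} {n d : ℕ} {A : Fin n → Fin d → ℝ} {y : Fin n → ℝ}
    {S : Set ℝ} (h : HoldsBest s A y S) (h16n : s'.nat 16 = s.nat 16) (h1 : s'.nat 1 = s.nat 1)
    (h15 : s'.real 15 = s.real 15) (h16 : s'.real 16 = s.real 16)
    (h17 : s'.real 17 = s.real 17) : HoldsBest s' A y S := by
  rcases h with ⟨h, hS⟩ | ⟨h, ⟨v, hv⟩, hc⟩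
  · exact .inl ⟨by rw [h16n, h], hS⟩
  · exact .inr ⟨by rw [h16n, h], ⟨v, hv.congr h15 h16 h17 h1⟩, by rwa [h15]⟩

/-- Store the candidate that has just been evaluated if it is better than the stored one. -/
def update : Program :=
  .branch (.not (.and (.natLT (.const 0) (natVar 16)) (.not (.realLT (realVar 13) (realVar 15)))))
    (.seq (setNatVar 16 (.const 1)) (.seq (setRealVar 15 (realVar 13))
      (.seq (setRealVar 16 (realVar 14))
        (.seq (forLoop 7 dimD (setRealAt 17 (natVar 7) (realAt 11 (natVar 7))))
          (forLoop 7 dimN (setNatAt 1 (natVar 7) (natAt 15 (natVar 7))))))))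
    .skip

theorem halts_update (s : State) {n d : ℕ} {A : Fin n → Fin d → ℝ} {y : Fin n → ℝ}
    {v : Fin d → ℝ} {S : Set ℝ} (hn : s.nat 0 0 0 = n) (hd : s.nat 0 0 1 = d)
    (hB : HoldsBest s A y S) (hC : HoldsCandidate s A y 13 14 11 15 v) :
    Halts update s (20 + (20 + (20 + ((d + 1) * 52 + (n + 1) * 52))) + 60) fun s' =>
      s'.nat 16 0 0 = 1 ∧ HoldsBest s' A y (S ∪ Set.range (leastSquaresObjective A y v)) := by
  refine Halts.branch ?_ ?_
  · intro hb
    have hmin : ∀ c ∈ S, s.real 13 0 0 ≤ c := by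
      rcases hB with ⟨-, rfl⟩ | ⟨h, -, hc⟩
      · simp
      · intro c hcS
        have : s.real 13 0 0 < s.real 15 0 0 := by
          simpa [Test.Holds, NExpr.eval, RExpr.eval, h] using hb
        exact this.le.trans (hc c hcS)
    refine Halts.seq_left (Halts.setNat ?_)
    refine Halts.seq_left (Halts.setReal ?_)
    refine Halts.seq_left (Halts.setReal ?_)
    set s₁ : State := ((s.writeNat 16 0 0 1).writeReal 15 0 0 (s.real 13 0 0)).writeReal 16 0 0
      (s.real 14 0 0) with hs₁
    change Halts _ s₁ _ _
    have h1 : Halts (forLoop 7 dimD (setRealAt 17 (natVar 7) (realAt 11 (natVar 7)))) s₁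
        ((d + 1) * 52) fun s' => ∀ j < d, s'.real 17 j 0 = s.real 11 j 0 := by
      refine Halts.forLoop (T := 20) (fun k s' => ∀ j < k, s'.real 17 j 0 = s.real 11 j 0)
        (by decide) (by decide) ?_ ?_ ?_
      · intro s' hF
        simp [NExpr.eval, hF.nat 0 (by decide), s₁, State.writeNat, State.writeReal, hd]
      · simp
      · intro k hk s' hF hk' hI
        refine Halts.setReal ?_
        intro j hj
        by_cases hjk : j = k
        · simp [NExpr.eval, RExpr.eval, State.writeNat, State.writeReal, hk', hjk,
            hF.real 11 (by decide), s₁]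
        · simpa [NExpr.eval, RExpr.eval, State.writeNat, State.writeReal, hk', hjk] using
            hI j (by omega)
    refine h1.seq fun s₂ hF₂ h₂ => ?_
    refine (Halts.forLoop (N := n) (T := 20) (fun k s' => ∀ j < k, s'.nat 1 j 0 = s.nat 15 j 0)
      (by decide) (by decide) ?_ ?_ ?_).weaken fun s₃ hF₃ h₃ => ?_
    · intro s' hF
      simp [NExpr.eval, hF.nat 0 (by decide), hF₂.nat 0 (by decide), s₁, State.writeNat,
        State.writeReal, hn]
    · simp
    · intro k hk s' hF hk' hI
      refine Halts.setNat ?_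
      intro j hj
      by_cases hjk : j = k
      · simp [NExpr.eval, State.writeNat, hk', hjk, State.writeReal,
          hF.nat 15 (by decide), hF₂.nat 15 (by decide), s₁]
      · simpa [NExpr.eval, State.writeNat, hk', hjk] using hI j (by omega)
    · obtain ⟨hu, σ, hσ, ho, hmin', hl⟩ := hC
      have e16 : s₃.nat 16 0 0 = 1 := by
        rw [hF₃.nat 16 (by decide), hF₂.nat 16 (by decide)]
        simp [s₁, State.writeReal, State.writeNat]
      have e15 : s₃.real 15 0 0 = s.real 13 0 0 := by
        rw [hF₃.real 15 (by decide), hF₂.real 15 (by decide)]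
        simp [s₁, State.writeReal]
      refine ⟨e16, .inr ⟨e16, ⟨v, ?_, σ, ?_, ?_, hmin', ?_⟩, ?_⟩⟩
      · intro j
        rw [hF₃.real 17 (by decide), h₂ j j.2, hu]
      · intro i
        rw [h₃ i i.2, hσ]
      · rw [e15, ho]
      · rw [hF₃.real 16 (by decide), hF₂.real 16 (by decide), ← hl]
        simp [s₁, State.writeReal]
      · rw [e15]
        rintro c (hc | ⟨τ, rfl⟩)
        · exact hmin c hc
        · rw [ho]; exact hmin' τ
  · intro hb
    refine Halts.skip ?_ (by omega)
    simp only [Test.Holds, NExpr.eval, RExpr.eval, not_not, not_lt] at hb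
    rcases hB with ⟨h, -⟩ | ⟨h, hv, hc⟩
    · omega
    · refine ⟨h, .inr ⟨h, hv, ?_⟩⟩
      obtain ⟨-, σ, -, ho, hmin', -⟩ := hC
      rintro c (hc' | ⟨τ, rfl⟩)
      · exact hc c hc'
      · exact hb.2.trans (ho ▸ hmin' τ)

/-- The number with the digits `D` in base `m`, the least significant digit first. -/
def digitValue (m d : ℕ) (D : ℕ → ℕ) : ℕ := ∑ j ∈ Finset.range d, D j * m ^ j

theorem digitValue_update {m d : ℕ} {D : ℕ → ℕ} {j : ℕ} (hj : j < d) (a : ℕ) :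
    digitValue m d (Function.update D j a) + D j * m ^ j = digitValue m d D + a * m ^ j := by
  have hj' : j ∈ Finset.range d := Finset.mem_range.2 hj
  rw [digitValue, digitValue, ← Finset.add_sum_erase _ _ hj', ← Finset.add_sum_erase _ _ hj']
  have : ∑ k ∈ (Finset.range d).erase j, Function.update D j a k * m ^ k =
      ∑ k ∈ (Finset.range d).erase j, D k * m ^ k :=
    Finset.sum_congr rfl fun k hk => by rw [Function.update_of_ne (Finset.ne_of_mem_erase hk)]
  rw [this, Function.update_self]
  ring

theorem digitValue_lt {m d : ℕ} {D : ℕ → ℕ} (hD : ∀ j < d, D j < m) : digitValue m d D < m ^ d := by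
  have := (finFunctionFinEquiv fun j : Fin d => (⟨D j, hD j j.2⟩ : Fin m)).2
  rwa [finFunctionFinEquiv_apply, ← Finset.sum_range (fun j => D j * m ^ j)] at this

theorem eq_of_digitValue_eq {m d : ℕ} {D : ℕ → ℕ} (hD : ∀ j < d, D j < m) {f : Fin d → Fin m}
    (h : ∑ j, (f j : ℕ) * m ^ (j : ℕ) = digitValue m d D) (j : Fin d) : (f j : ℕ) = D j := by
  have : f = fun j : Fin d => (⟨D j, hD j j.2⟩ : Fin m) := by
    apply finFunctionFinEquiv.injective
    rw [Fin.ext_iff, finFunctionFinEquiv_apply, finFunctionFinEquiv_apply, h, digitValue,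
      Finset.sum_range]
  rw [this]

/-- Add one to the number whose digits, in the base held in natural variable `10`, are in natural
array `11`. In case of an overflow, set variable `17` to one. -/
def increment : Program :=
  .seq (setNatVar 8 (.const 0))
    (.seq (.loop (.and (.natLT (natVar 8) dimD)
        (.not (.natLT (.add (natAt 11 (natVar 8)) (.const 1)) (natVar 10))))
      (.seq (setNatAt 11 (natVar 8) (.const 0)) (setNatVar 8 (.add (natVar 8) (.const 1)))))
    (.branch (.natLT (natVar 8) dimD)
      (setNatAt 11 (natVar 8) (.add (natAt 11 (natVar 8)) (.const 1)))
      (setNatVar 17 (.const 1))))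

/-- On the last of the `m ^ d` digit strings the final flag is raised instead. -/
theorem halts_increment (s : State) {d m : ℕ} (hd : s.nat 0 0 1 = d) (hm : s.nat 10 0 0 = m)
    (h17 : s.nat 17 0 0 = 0) (hD : ∀ j < d, s.nat 11 j 0 < m) :
    Halts increment s (20 + ((d + 1) * 70 + (20 + 60))) fun s' =>
      (s'.nat 17 0 0 = 0 ∧ (∀ j < d, s'.nat 11 j 0 < m) ∧
        digitValue m d (fun j => s'.nat 11 j 0) = digitValue m d (fun j => s.nat 11 j 0) + 1) ∨
      (s'.nat 17 0 0 = 1 ∧ digitValue m d (fun j => s.nat 11 j 0) + 1 = m ^ d) := by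
  have hupd : ∀ (s' : State) (k a : ℕ), (fun j => (s'.writeNat 11 k 0 a).nat 11 j 0) =
      Function.update (fun j => s'.nat 11 j 0) k a := by
    intro s' k a
    funext j
    by_cases hjk : j = k
    · subst hjk; simp [State.writeNat]
    · simp [State.writeNat, hjk]
  refine Halts.seq_left (Halts.setNat ?_)
  -- With the carry counted at position `k`, the number has its new value already: the invariant
  -- is `value + m ^ k = old value + 1`, and the digits below position `k` are zero.
  refine ((Halts.loop (v := d) (T := 40) (fun v s' => v + s'.nat 8 0 0 = d ∧
      (∀ j < d, s'.nat 11 j 0 < m) ∧ (∀ j < s'.nat 8 0 0, s'.nat 11 j 0 = 0) ∧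
      digitValue m d (fun j => s'.nat 11 j 0) + m ^ s'.nat 8 0 0 =
        digitValue m d (fun j => s.nat 11 j 0) + 1) ?_ ?_).time
    (T' := (d + 1) * 70) ?_).seq fun s₁ hF₁ h₁ => ?_
  · simpa [State.writeNat, NExpr.eval] using hD
  · rintro v s₁ hF₁ ⟨hv, hlt, hz, hval⟩ hb
    have e0 : s₁.nat 0 0 1 = d := by
      rw [hF₁.nat 0 (by decide), ← hd]
      simp [State.writeNat]
    have e10 : s₁.nat 10 0 0 = m := by
      rw [hF₁.nat 10 (by decide), ← hm]
      simp [State.writeNat]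
    simp only [Test.Holds, NExpr.eval, e0, e10, not_lt] at hb
    refine Halts.seq_left (T := 20) (T' := 20) (Halts.setNat ?_)
    refine Halts.setNat ⟨v - 1, by omega, ?_, ?_, ?_, ?_⟩
    · simp [State.writeNat, NExpr.eval]; omega
    · intro j hj
      have := hlt j hj
      by_cases hjk : j = s₁.nat 8 0 0
      · simp [State.writeNat, NExpr.eval, hjk]; omega
      · simpa [State.writeNat, NExpr.eval, hjk] using this
    · intro j hj
      by_cases hjk : j = s₁.nat 8 0 0
      · simp [State.writeNat, NExpr.eval, hjk]
      · have hj' : j < s₁.nat 8 0 0 := by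
          simp [State.writeNat, NExpr.eval] at hj
          omega
        simpa [State.writeNat, NExpr.eval, hjk] using hz j hj'
    · have h1 := digitValue_update (m := m) (D := fun j => s₁.nat 11 j 0) hb.1 0
      rw [← hupd] at h1
      simp only [State.writeNat, NExpr.eval] at h1 ⊢
      have h2 : s₁.nat 11 (s₁.nat 8 0 0) 0 + 1 = m := le_antisymm (hlt _ hb.1) hb.2
      simp only [true_and, and_true, and_self, if_true, Nat.reduceEqDiff, false_and,
        if_false] at h1 ⊢
      rw [pow_succ]
      have h3 : m ^ s₁.nat 8 0 0 * m = s₁.nat 11 (s₁.nat 8 0 0) 0 * m ^ s₁.nat 8 0 0 +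
          m ^ s₁.nat 8 0 0 := by
        rw [← Nat.succ_mul, Nat.succ_eq_add_one, h2, mul_comm]
      omega
  · exact Nat.mul_le_mul_left _ (by simp [Test.cost, NExpr.cost])
  · obtain ⟨hb, v, hv, hlt, hz, hval⟩ := h₁
    have e0 : s₁.nat 0 0 1 = d := by
      rw [hF₁.nat 0 (by decide), ← hd]
      simp [State.writeNat]
    have e10 : s₁.nat 10 0 0 = m := by
      rw [hF₁.nat 10 (by decide), ← hm]
      simp [State.writeNat]
    have e17 : s₁.nat 17 0 0 = 0 := by
      rw [hF₁.nat 17 (by decide)]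
      simpa [State.writeNat] using h17
    simp only [Test.Holds, NExpr.eval, e0, e10, not_and, not_not] at hb
    refine Halts.branch ?_ ?_
    · intro hlt8
      simp only [Test.Holds, NExpr.eval, e0] at hlt8
      refine Halts.setNat (.inl ⟨?_, ?_, ?_⟩)
      · simpa [State.writeNat, NExpr.eval] using e17
      · intro j hj
        by_cases hjk : j = s₁.nat 8 0 0
        · simpa [State.writeNat, NExpr.eval, hjk] using hb hlt8
        · simpa [State.writeNat, NExpr.eval, hjk] using hlt j hj
      · have h1 := digitValue_update (m := m) (D := fun j => s₁.nat 11 j 0) hlt8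
          (s₁.nat 11 (s₁.nat 8 0 0) 0 + 1)
        rw [← hupd] at h1
        simp only [NExpr.eval]
        rw [add_mul, one_mul] at h1
        omega
    · intro hge8
      simp only [Test.Holds, NExpr.eval, e0, not_lt] at hge8
      have h8 : s₁.nat 8 0 0 = d := by omega
      refine Halts.setNat (.inr ⟨?_, ?_⟩)
      · simp [State.writeNat, NExpr.eval]
      · rw [← hval, h8]
        have : digitValue m d (fun j => s₁.nat 11 j 0) = 0 :=
          Finset.sum_eq_zero fun j hj => by
            simp [hz j (by rw [h8]; exact Finset.mem_range.1 hj)]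
        rw [this, zero_add]

/-- Evaluate all coefficient vectors whose entries are among the candidates in real array `10`. -/
def enumerate : Program :=
  .seq (forLoop 7 dimD (setNatAt 11 (natVar 7) (.const 0)))
    (.seq (setNatVar 17 (.const 0))
      (.loop (.natLT (natVar 17) (.const 1)) (.seq evaluate (.seq update increment))))

theorem halts_enumerate (s : State) {n d m : ℕ} {A : Fin n → Fin d → ℝ} {y : Fin n → ℝ}
    {S : Set ℝ} (hn : s.nat 0 0 0 = n) (hd : s.nat 0 0 1 = d)
    (hA : ∀ (i : Fin n) (j : Fin d), s.real 0 i j = A i j) (hy : ∀ i : Fin n, s.real 1 i 0 = y i)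
    (hm : s.nat 10 0 0 = m) (hm1 : 1 ≤ m) (hB : HoldsBest s A y S) :
    Halts enumerate s (3000 * ((n + 2) ^ 2 * (d + 1) * m ^ d)) fun s' =>
      s'.nat 16 0 0 = 1 ∧ HoldsBest s' A y (S ∪ {c | ∃ v : Fin d → ℝ,
        (∀ j, ∃ k < m, v j = s.real 10 k 0) ∧ c ∈ Set.range (leastSquaresObjective A y v)}) := by
  have h1 : Halts (forLoop 7 dimD (setNatAt 11 (natVar 7) (.const 0))) s
      ((d + 1) * 52) fun s' => ∀ j < d, s'.nat 11 j 0 = 0 := by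
    refine Halts.forLoop (T := 20) (fun k s' => ∀ j < k, s'.nat 11 j 0 = 0)
      (by decide) (by decide) ?_ ?_ ?_
    · intro s' hF
      simp [NExpr.eval, hF.nat 0 (by decide), hd]
    · simp
    · intro k hk s' hF hk' hI
      refine Halts.setNat ?_
      intro j hj
      by_cases hjk : j = k
      · simp [NExpr.eval, State.writeNat, hk', hjk]
      · simpa [NExpr.eval, State.writeNat, hk', hjk] using hI j (by omega)
  refine (h1.seq (T' := 20 + (m ^ d + 1) * (1000 * ((n + 2) ^ 2 * (d + 1)) +
    ((20 + (20 + (20 + ((d + 1) * 52 + (n + 1) * 52))) + 60) +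
      (20 + ((d + 1) * 70 + (20 + 60)))) + 5 + 1)) fun s₁ hF₁ h₁ => ?_).time ?_
  · refine Halts.seq_left (Halts.setNat ?_)
    -- `visited t` collects the objective values of the candidates with numbers below `t`.
    let visited : ℕ → Set ℝ := fun t => {c | ∃ f : Fin d → Fin m,
      ∑ j, (f j : ℕ) * m ^ (j : ℕ) < t ∧
        c ∈ Set.range (leastSquaresObjective A y fun j => s.real 10 (f j) 0)}
    -- The candidate with the current digits has yet to be evaluated, and `r` candidates remain.
    refine (Halts.loop (v := m ^ d) (fun r s' =>
      (s'.nat 17 0 0 = 0 ∧ (∀ j < d, s'.nat 11 j 0 < m) ∧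
        r + digitValue m d (fun j => s'.nat 11 j 0) = m ^ d ∧
        HoldsBest s' A y (S ∪ visited (digitValue m d (fun j => s'.nat 11 j 0)))) ∨
      (s'.nat 17 0 0 = 1 ∧ s'.nat 16 0 0 = 1 ∧ HoldsBest s' A y (S ∪ visited (m ^ d))))
      ?_ ?_).weaken
      fun s₂ hF₂ h₂ => ?_
    · have h0 : ∀ j < d, (s₁.writeNat 17 0 0 0).nat 11 j 0 = 0 := by
        simpa [State.writeNat] using h₁
      have hv0 : digitValue m d (fun j => (s₁.writeNat 17 0 0 0).nat 11 j 0) = 0 :=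
        Finset.sum_eq_zero fun j hj => by
          simp [h0 j (Finset.mem_range.1 hj)]
      refine .inl ⟨?_, ?_, ?_, ?_⟩
      · simp [State.writeNat, NExpr.eval]
      · intro j hj
        have := h0 j hj
        simp only [NExpr.eval]
        omega
      · simp only [NExpr.eval]
        rw [hv0, add_zero]
      · simp only [NExpr.eval]
        rw [hv0]
        refine (hB.congr ?_ ?_ ?_ ?_ ?_).mono ?_
        · rw [← hF₁.nat 16 (by decide)]
          simp [State.writeNat]
        · rw [← hF₁.nat 1 (by decide)]
          simp [State.writeNat]
        · exact hF₁.real 15 (by decide)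
        · exact hF₁.real 16 (by decide)
        · exact hF₁.real 17 (by decide)
        · simp [visited]
    · rintro r s₂ hF₂ (⟨h17, hD, hr, hB₂⟩ | ⟨h17, -⟩) hb
      swap
      · simp [Test.Holds, NExpr.eval, h17] at hb
      have e0 : s₂.nat 0 = s.nat 0 := by
        rw [hF₂.nat 0 (by decide), ← hF₁.nat 0 (by decide)]
        simp [State.writeNat]
      have e10 : s₂.nat 10 0 0 = m := by
        rw [hF₂.nat 10 (by decide), ← hm, ← hF₁.nat 10 (by decide)]
        simp [State.writeNat]
      have e10r : s₂.real 10 = s.real 10 := by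
        rw [hF₂.real 10 (by decide)]
        exact hF₁.real 10 (by decide)
      refine (halts_evaluate s₂ (A := A) (y := y) (n := n) (d := d) (by rw [e0, hn])
        (by rw [e0, hd]) ?_ ?_).seq fun s₃ hF₃ h₃ => ?_
      · rw [hF₂.real 0 (by decide)]
        exact (hF₁.real 0 (by decide)) ▸ hA
      · rw [hF₂.real 1 (by decide)]
        exact (hF₁.real 1 (by decide)) ▸ hy
      have e₃0 : s₃.nat 0 = s.nat 0 := by rw [hF₃.nat 0 (by decide), e0]
      refine (halts_update s₃ (n := n) (d := d) (by rw [e₃0, hn]) (by rw [e₃0, hd])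
        (hB₂.congr (hF₃.nat 16 (by decide)) (hF₃.nat 1 (by decide)) (hF₃.real 15 (by decide))
        (hF₃.real 16 (by decide)) (hF₃.real 17 (by decide))) h₃).seq fun s₄ hF₄ h₄ => ?_
      have e₄11 : s₄.nat 11 = s₂.nat 11 := by
        rw [hF₄.nat 11 (by decide), hF₃.nat 11 (by decide)]
      refine (halts_increment s₄ (d := d) (m := m) ?_ ?_ ?_ ?_).weaken fun s₅ hF₅ h₅ => ?_
      · rw [hF₄.nat 0 (by decide), e₃0, hd]
      · rw [hF₄.nat 10 (by decide), hF₃.nat 10 (by decide), e10]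
      · rw [hF₄.nat 17 (by decide), hF₃.nat 17 (by decide), h17]
      · rw [e₄11]; exact hD
      rw [e₄11] at h₅
      have hlt := digitValue_lt hD
      have hB₅ : HoldsBest s₅ A y
          (S ∪ visited (digitValue m d (fun j => s₂.nat 11 j 0) + 1)) := by
        refine (h₄.2.congr (hF₅.nat 16 (by decide)) (hF₅.nat 1 (by decide))
          (hF₅.real 15 (by decide)) (hF₅.real 16 (by decide)) (hF₅.real 17 (by decide))).mono ?_
        rintro c (hc | ⟨f, hf, hc⟩)
        · exact .inl (.inl hc)
        · rcases Nat.lt_succ_iff_lt_or_eq.1 hf with hf | hf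
          · exact .inl (.inr ⟨f, hf, hc⟩)
          · right
            have hfD := eq_of_digitValue_eq hD hf
            simpa only [hfD, e10r] using hc
      rcases h₅ with ⟨h17', hD', hval⟩ | ⟨h17', hval⟩
      · refine ⟨r - 1, by omega, .inl ⟨h17', hD', by omega, ?_⟩⟩
        rw [hval]
        exact hB₅
      · refine ⟨r - 1, by omega, .inr ⟨h17', ?_, ?_⟩⟩
        · rw [hF₅.nat 16 (by decide), h₄.1]
        · rw [← hval]
          exact hB₅
    · obtain ⟨hb, r, ⟨h17, -⟩ | ⟨h17, h16, hB₂⟩⟩ := h₂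
      · simp [Test.Holds, NExpr.eval, h17] at hb
      · refine ⟨h16, hB₂.mono ?_⟩
        rintro c (hc | ⟨v, hv, hc⟩)
        · exact .inl hc
        · choose f hf hvf using hv
          refine .inr ⟨fun j => ⟨f j, hf j⟩, ?_, ?_⟩
          · have h := (finFunctionFinEquiv fun j => (⟨f j, hf j⟩ : Fin m)).2
            rwa [finFunctionFinEquiv_apply] at h
          · rwa [← funext hvf]
  · have hG : 1 ≤ m ^ d := Nat.one_le_pow _ _ hm1
    generalize m ^ d = G at hG
    obtain ⟨G, rfl⟩ := Nat.exists_eq_add_of_le hG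
    ring_nf
    nlinarith [Nat.zero_le (n * d), Nat.zero_le (n * d * G), Nat.zero_le (n ^ 2 * d),
      Nat.zero_le (n ^ 2 * d * G), Nat.zero_le (n * G), Nat.zero_le (d * G),
      Nat.zero_le (n ^ 2 * G)]

end RealRAM

/-! ### Approximation by grids around the responses -/

section Approximation

variable {n d : ℕ}

theorem leastSquaresObjective_nonneg (x : Fin n → Fin d → ℝ) (y : Fin n → ℝ) (w : Fin d → ℝ)
    (π : Equiv.Perm (Fin n)) : 0 ≤ leastSquaresObjective x y w π :=
  Finset.sum_nonneg fun _ _ => sq_nonneg _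

theorem abs_residual_le {x : Fin n → Fin d → ℝ} {y : Fin n → ℝ} {w : Fin d → ℝ}
    {π : Equiv.Perm (Fin n)} {a : ℝ} (ha : 0 ≤ a) (h : leastSquaresObjective x y w π ≤ a ^ 2)
    (i : Fin n) : |w ⬝ᵥ x (π i) - y i| ≤ a := by
  refine abs_le_of_sq_le_sq (le_trans ?_ h) ha
  exact Finset.single_le_sum (f := fun i => (w ⬝ᵥ x (π i) - y i) ^ 2)
    (fun _ _ => sq_nonneg _) (Finset.mem_univ i)

theorem leastSquaresObjective_le_sq_sum (x : Fin n → Fin d → ℝ) (y : Fin n → ℝ) (w : Fin d → ℝ)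
    (π : Equiv.Perm (Fin n)) :
    leastSquaresObjective x y w π ≤ (∑ i, |w ⬝ᵥ x (π i) - y i|) ^ 2 := by
  have := Finset.sum_sq_le_sq_sum_of_nonneg (s := Finset.univ) (f := fun i => |w ⬝ᵥ x (π i) - y i|)
    fun _ _ => abs_nonneg _
  simpa [leastSquaresObjective] using this

/-- If all predictions change by at most `θ`, then the objective value changes little. -/
theorem leastSquaresObjective_perturb {x x' : Fin n → Fin d → ℝ} {y : Fin n → ℝ}
    {w w' : Fin d → ℝ} {π : Equiv.Perm (Fin n)} {a θ : ℝ} (ha : 0 ≤ a) (hθ : 0 ≤ θ)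
    (h : leastSquaresObjective x y w π ≤ a ^ 2) (hw : ∀ i, |w' ⬝ᵥ x' i - w ⬝ᵥ x i| ≤ θ) :
    leastSquaresObjective x' y w' π ≤ a ^ 2 + 2 * n * θ * a + n * θ ^ 2 := by
  have key : ∀ i, (w' ⬝ᵥ x' (π i) - y i) ^ 2 ≤
      (w ⬝ᵥ x (π i) - y i) ^ 2 + (2 * θ * a + θ ^ 2) := by
    intro i
    have h1 := abs_residual_le ha h i
    have h2 := hw (π i)
    have h3 : |w' ⬝ᵥ x' (π i) - y i| ≤ |w ⬝ᵥ x (π i) - y i| + θ := by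
      have := abs_add_le (w ⬝ᵥ x (π i) - y i) (w' ⬝ᵥ x' (π i) - w ⬝ᵥ x (π i))
      rw [show w ⬝ᵥ x (π i) - y i + (w' ⬝ᵥ x' (π i) - w ⬝ᵥ x (π i)) = w' ⬝ᵥ x' (π i) - y i by
        ring] at this
      linarith
    rw [← sq_abs (w' ⬝ᵥ x' (π i) - y i), ← sq_abs (w ⬝ᵥ x (π i) - y i)]
    have h4 := pow_le_pow_left₀ (abs_nonneg _) h3 2
    have h5 := mul_le_mul_of_nonneg_left h1 hθ
    nlinarith
  have h1 := Finset.sum_le_sum fun i (_ : i ∈ Finset.univ) => key i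
  rw [Finset.sum_add_distrib, Finset.sum_const, Finset.card_univ, Fintype.card_fin,
    nsmul_eq_mul] at h1
  simp only [leastSquaresObjective] at h ⊢
  nlinarith

/-- A point of `[0, 2 * L]` is close to one of the grid points `k * (L / K)` with `k ≤ 2 * K`. -/
theorem exists_grid_point {L t : ℝ} {K : ℕ} (hK : 0 < K) (ht : 0 ≤ t) (htL : t ≤ 2 * L) :
    ∃ k < K + K + 1, |k * (L / K) - t| ≤ L / K := by
  have hK' : (0 : ℝ) < K := Nat.cast_pos.2 hK
  have hL : 0 ≤ L := by linarith
  rcases hL.eq_or_lt with rfl | hL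
  · exact ⟨0, by omega, by simp; linarith⟩
  · have hδ : 0 < L / K := by positivity
    refine ⟨⌊t / (L / K)⌋₊, ?_, ?_⟩
    · rw [Nat.lt_succ_iff]
      refine Nat.floor_le_of_le ?_
      rw [div_le_iff₀ hδ]
      push_cast
      field_simp
      linarith
    · have h1 := Nat.floor_le (div_nonneg ht hδ.le)
      have h2 := Nat.lt_floor_add_one (t / (L / K))
      rw [le_div_iff₀ hδ] at h1
      rw [div_lt_iff₀ hδ] at h2
      rw [abs_le]
      constructor <;> nlinarith

/-- A linear functional `w` in the coordinates of a basis: `w` applied to the basis vectors. -/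
def basisCoord (X : Matrix (Fin n) (Fin d) ℝ) (b : Fin d → Option (Fin n)) (w : Fin d → ℝ) :
    Fin d → ℝ := (basisMatrix X b).mulVec w

theorem basisCoord_of_some {X : Matrix (Fin n) (Fin d) ℝ} {b : Fin d → Option (Fin n)}
    {j : Fin d} {i : Fin n} (h : b j = some i) (w : Fin d → ℝ) :
    basisCoord X b w j = w ⬝ᵥ X i := by
  simp [basisCoord, Matrix.mulVec, basisMatrix, h, dotProduct, mul_comm]

theorem dotProduct_basisCoord {X : Matrix (Fin n) (Fin d) ℝ} {b : Fin d → Option (Fin n)}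
    {T : Matrix (Fin d) (Fin d) ℝ} (hT : basisMatrix X b * T = 1) (w : Fin d → ℝ) (i : Fin n) :
    basisCoord X b w ⬝ᵥ (X * T) i = w ⬝ᵥ X i := by
  have h1 : T * basisMatrix X b = 1 := mul_eq_one_comm.1 hT
  have h2 : (X * T).mulVec (basisCoord X b w) = X.mulVec w := by
    rw [basisCoord, Matrix.mulVec_mulVec, Matrix.mul_assoc, h1, Matrix.mul_one]
  have h3 := congrFun h2 i
  rw [dotProduct_comm, dotProduct_comm w]
  exact h3

theorem mulVec_dotProduct {X : Matrix (Fin n) (Fin d) ℝ} {T : Matrix (Fin d) (Fin d) ℝ}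
    (u : Fin d → ℝ) (i : Fin n) : T.mulVec u ⬝ᵥ X i = u ⬝ᵥ (X * T) i := by
  have h2 : (X * T).mulVec u = X.mulVec (T.mulVec u) := by rw [Matrix.mulVec_mulVec]
  have h3 := congrFun h2 i
  rw [dotProduct_comm, dotProduct_comm u]
  exact h3.symm

/-- Since the data points have coordinates at most one with respect to the basis, and at most `n`
coordinates matter, approximate values on the basis give approximate predictions. -/
theorem abs_dotProduct_sub_le {X : Matrix (Fin n) (Fin d) ℝ} {b : Fin d → Option (Fin n)}
    {T : Matrix (Fin d) (Fin d) ℝ} (hT : basisMatrix X b * T = 1)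
    (h0 : ∀ i j, b j = none → (X * T) i j = 0) (h1 : ∀ i j, |(X * T) i j| ≤ 1)
    {w v : Fin d → ℝ} {η : ℝ} (hη : 0 ≤ η)
    (hv : ∀ j i, b j = some i → |v j - w ⬝ᵥ X i| ≤ η) (i : Fin n) :
    |v ⬝ᵥ (X * T) i - w ⬝ᵥ X i| ≤ n * η := by
  rw [← dotProduct_basisCoord hT, ← sub_dotProduct, dotProduct]
  refine (Finset.abs_sum_le_sum_abs _ _).trans ?_
  have key : ∀ j, |(v - basisCoord X b w) j * (X * T) i j| ≤ if (b j).isSome then η else 0 := by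
    intro j
    rw [abs_mul]
    cases hj : b j with
    | none => simp [h0 i j hj]
    | some i' =>
      have := hv j i' hj
      rw [← basisCoord_of_some hj] at this
      simp only [Option.isSome_some, if_true, Pi.sub_apply]
      calc _ ≤ η * 1 := mul_le_mul this (h1 i j) (abs_nonneg _) hη
        _ = η := mul_one η
  refine (Finset.sum_le_sum fun j _ => key j).trans ?_
  rw [← Finset.sum_filter, Finset.sum_const, nsmul_eq_mul]
  exact mul_le_mul_of_nonneg_right (by exact_mod_cast card_basis_le hT) hη

/-- The approximation guarantee. The number `o₁` is the best objective value for vectors of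
coordinates that are responses, `L` is the corresponding sum of absolute residuals, and `o₂` is
the best value for vectors of coordinates in the grids of width `L / K` and radius `L` around the
responses. -/
theorem approximation_guarantee {X : Matrix (Fin n) (Fin d) ℝ} {b : Fin d → Option (Fin n)}
    {T : Matrix (Fin d) (Fin d) ℝ} {y : Fin n → ℝ} {ε : ℝ} {K : ℕ}
    (hT : basisMatrix X b * T = 1) (h0 : ∀ i j, b j = none → (X * T) i j = 0)
    (h1 : ∀ i j, |(X * T) i j| ≤ 1) (hε : 0 < ε) (hε1 : ε < 1)
    (hK : 3 * ((n : ℝ) + 1) ^ 5 ≤ K * ε)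
    {o₁ o₂ : ℝ} {u : Fin d → ℝ} {σ : Equiv.Perm (Fin n)}
    (ho₁ : o₁ = leastSquaresObjective (X * T) y u σ)
    (hmin₁ : ∀ v τ, (∀ j, ∃ i, v j = y i) → o₁ ≤ leastSquaresObjective (X * T) y v τ)
    (h21 : o₂ ≤ o₁)
    (hmin₂ : ∀ v τ, (∀ j, ∃ i, ∃ k < K + K + 1, v j =
        y i - (∑ i, |u ⬝ᵥ (X * T) (σ i) - y i|) +
          k * ((∑ i, |u ⬝ᵥ (X * T) (σ i) - y i|) / K)) →
      o₂ ≤ leastSquaresObjective (X * T) y v τ)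
    (hn : 0 < n) (w : Fin d → ℝ) (τ : Equiv.Perm (Fin n)) :
    o₂ ≤ (1 + ε) * leastSquaresObjective X y w τ := by
  set L := ∑ i, |u ⬝ᵥ (X * T) (σ i) - y i| with hL
  have hL0 : 0 ≤ L := Finset.sum_nonneg fun _ _ => abs_nonneg _
  set a := √(leastSquaresObjective X y w τ) with ha
  have ha0 : 0 ≤ a := Real.sqrt_nonneg _
  have ha2 : leastSquaresObjective X y w τ = a ^ 2 :=
    (Real.sq_sqrt (leastSquaresObjective_nonneg _ _ _ _)).symm
  have hres : ∀ i, |w ⬝ᵥ X (τ i) - y i| ≤ a := abs_residual_le ha0 ha2.le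
  have hres' : ∀ i, |w ⬝ᵥ X i - y (τ.symm i)| ≤ a := by
    intro i
    simpa using hres (τ.symm i)
  have hn1 : (1 : ℝ) ≤ n := Nat.one_le_cast.2 hn
  have hKpos : 0 < K := by
    rcases Nat.eq_zero_or_pos K with rfl | h
    · have : (0 : ℝ) < 3 * ((n : ℝ) + 1) ^ 5 := by positivity
      simp only [Nat.cast_zero, zero_mul] at hK
      linarith
    · exact h
  have hK0 : (0 : ℝ) < K := Nat.cast_pos.2 hKpos
  -- The responses matched with the basis points are coordinates with error at most `a`.
  have ho₁a : o₁ ≤ (((n : ℝ) + 1) ^ 2 * a) ^ 2 := by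
    let v : Fin d → ℝ := fun j => y (τ.symm ((b j).getD ⟨0, hn⟩))
    have h2 := hmin₁ v τ fun j => ⟨_, rfl⟩
    have h3 := leastSquaresObjective_perturb (x' := X * T) (w' := v) (θ := n * a) ha0
      (by positivity) ha2.le (abs_dotProduct_sub_le hT h0 h1 ha0 fun j i hj => by
        simp only [v, hj, Option.getD_some]
        rw [abs_sub_comm]
        exact hres' i)
    refine h2.trans (h3.trans ?_)
    have h4 : 0 ≤ a ^ 2 := sq_nonneg a
    have h5 : (1 : ℝ) + 2 * n * n + n * n ^ 2 ≤ ((n : ℝ) + 1) ^ 4 := by nlinarith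
    nlinarith [mul_le_mul_of_nonneg_right h5 h4]
  rw [ha2]
  -- If the radius `L` does not reach the competitor, the first round has beaten it already.
  rcases lt_or_ge L a with hLa | hLa
  · have h2 : o₁ ≤ L ^ 2 := ho₁ ▸ leastSquaresObjective_le_sq_sum _ _ _ _
    have h3 : L ^ 2 ≤ a ^ 2 := pow_le_pow_left₀ hL0 hLa.le 2
    have h4 := mul_nonneg hε.le (sq_nonneg a)
    linarith
  · have hLle : L ≤ n * (((n : ℝ) + 1) ^ 2 * a) := by
      have h2 := Finset.sum_le_sum fun i (_ : i ∈ Finset.univ) =>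
        abs_residual_le (by positivity : 0 ≤ ((n : ℝ) + 1) ^ 2 * a) (ho₁ ▸ ho₁a) i
      rwa [Finset.sum_const, Finset.card_univ, Fintype.card_fin, nsmul_eq_mul] at h2
    have hgrid : ∀ j, ∃ k < K + K + 1, ∀ i, b j = some i →
        |(k : ℝ) * (L / K) - (w ⬝ᵥ X i - y (τ.symm i) + L)| ≤ L / K := by
      intro j
      cases hj : b j with
      | none => exact ⟨0, by omega, by simp⟩
      | some i =>
        have := abs_le.1 (hres' i)
        obtain ⟨k, hk, h⟩ := exists_grid_point (L := L) (t := w ⬝ᵥ X i - y (τ.symm i) + L) hKpos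
          (by linarith) (by linarith)
        refine ⟨k, hk, fun i' hi' => ?_⟩
        obtain rfl : i = i' := by simpa using hi'
        exact h
    choose k hk hkb using hgrid
    let v : Fin d → ℝ := fun j => y (τ.symm ((b j).getD ⟨0, hn⟩)) - L + k j * (L / K)
    have hη : 0 ≤ L / K := by positivity
    have h2 := hmin₂ v τ fun j => ⟨_, k j, hk j, rfl⟩
    have h3 := leastSquaresObjective_perturb (x' := X * T) (w' := v) (θ := n * (L / K)) ha0
      (by positivity) ha2.le (abs_dotProduct_sub_le hT h0 h1 hη fun j i hj => by
        simp only [v, hj, Option.getD_some]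
        refine le_trans (le_of_eq ?_) (hkb j i hj)
        congr 1
        ring)
    refine h2.trans (h3.trans ?_)
    set θ := (n : ℝ) * (L / K) with hθ
    have hθ0 : 0 ≤ θ := by positivity
    -- The constant `3 (n + 1) ^ 5` in the choice of `K` makes `(n + 1) θ ≤ ε a / 3`.
    have h5 : ((n : ℝ) + 1) * θ ≤ ε * a / 3 := by
      have h6 : θ * K ≤ ((n : ℝ) + 1) ^ 4 * a := by
        rw [hθ, mul_assoc, div_mul_cancel₀ _ hK0.ne']
        calc (n : ℝ) * L ≤ n * (n * (((n : ℝ) + 1) ^ 2 * a)) := by gcongr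
          _ = (n : ℝ) ^ 2 * (((n : ℝ) + 1) ^ 2 * a) := by ring
          _ ≤ ((n : ℝ) + 1) ^ 2 * (((n : ℝ) + 1) ^ 2 * a) := by gcongr; linarith
          _ = _ := by ring
      have h7 : 3 * ((n : ℝ) + 1) ^ 5 * (((n : ℝ) + 1) * θ) ≤
          ((n : ℝ) + 1) ^ 5 * (ε * a) := by
        calc _ ≤ (K * ε) * (((n : ℝ) + 1) * θ) := by gcongr
          _ = ε * ((n : ℝ) + 1) * (θ * K) := by ring
          _ ≤ ε * ((n : ℝ) + 1) * (((n : ℝ) + 1) ^ 4 * a) := by gcongr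
          _ = _ := by ring
      have h8 : (0 : ℝ) < ((n : ℝ) + 1) ^ 5 := by positivity
      rw [le_div_iff₀ (by norm_num)]
      refine le_of_mul_le_mul_left ?_ h8
      linarith
    have h6 : n * θ ≤ ε * a / 3 := by linarith
    have h7 : θ ≤ a := by
      have : ε * a ≤ 1 * a := by gcongr
      nlinarith
    have h8 : n * θ * a ≤ ε * a / 3 * a := by gcongr
    have h9 : n * θ * θ ≤ ε * a / 3 * a := by gcongr
    nlinarith

end Approximation

/-! ### The grids and the whole algorithm -/

namespace RealRAM

/-- The number `K` of grid points on either side of a response. The constant is the one required by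
`approximation_guarantee`. -/
noncomputable def gridRadius (n : ℕ) (ε : ℝ) : ℕ := ⌈3 * ((n : ℝ) + 1) ^ 5 / ε⌉₊

/-- Compute the number `K`, as a natural number in variable `9` and as a real number in
variable `9`. There is no conversion between the two types, so both are counted up together. -/
def computeRadius : Program :=
  .seq (forLoop 6 dimN (setRealVar 8 (.add (realVar 8) (.const 1))))
    (.seq (setRealVar 8 (.add (realVar 8) (.const 1)))
      (.seq (setRealVar 18 (.mul (.const 3) (.mul (realVar 8) (.mul (realVar 8) (.mul (realVar 8)
        (.mul (realVar 8) (realVar 8)))))))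
        (.loop (.realLT (.mul (realVar 9) (realVar 2)) (realVar 18))
          (.seq (setRealVar 9 (.add (realVar 9) (.const 1)))
            (setNatVar 9 (.add (natVar 9) (.const 1)))))))

/-- The loop stops at the least `K` with `3 (n + 1) ^ 5 ≤ K ε`, which is `gridRadius n ε`. -/
theorem halts_computeRadius (s : State) {n : ℕ} {ε : ℝ} (hn : s.nat 0 0 0 = n)
    (hε : s.real 2 0 0 = ε) (hε0 : 0 < ε) (h8 : s.real 8 0 0 = 0) (h9 : s.real 9 0 0 = 0)
    (h9n : s.nat 9 0 0 = 0) :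
    Halts computeRadius s ((n + 1) * 52 + (20 + (40 + (gridRadius n ε + 1) * 60))) fun s' =>
      s'.nat 9 0 0 = gridRadius n ε ∧ s'.real 9 0 0 = gridRadius n ε := by
  have h1 : Halts (forLoop 6 dimN (setRealVar 8 (.add (realVar 8) (.const 1)))) s
      ((n + 1) * 52) fun s' => s'.real 8 0 0 = n := by
    refine Halts.forLoop (T := 20) (fun k s' => s'.real 8 0 0 = k)
      (by decide) (by decide) ?_ ?_ ?_
    · intro s' hF
      simp [NExpr.eval, hF.nat 0 (by decide), hn]
    · simp [State.writeNat, h8]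
    · intro k hk s' hF hk' hI
      refine Halts.setReal ?_
      simp [State.writeNat, State.writeReal, NExpr.eval, RExpr.eval, hI]
  refine h1.seq fun s₁ hF₁ h₁ => ?_
  refine Halts.seq_left (Halts.setReal ?_)
  refine Halts.seq_left (Halts.setReal ?_)
  refine ((Halts.loop (v := gridRadius n ε) (T := 40) (fun v s' =>
    v + s'.nat 9 0 0 = gridRadius n ε ∧ s'.real 9 0 0 = s'.nat 9 0 0) ?_ ?_).time ?_).weaken ?_
  · simp [State.writeReal, hF₁.nat 9 (by decide), h9n, hF₁.real 9 (by decide), h9]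
  · rintro v s₂ hF₂ ⟨hv, h9r⟩ hb
    have e2 : s₂.real 2 0 0 = ε := by
      rw [hF₂.real 2 (by decide), ← hε, ← hF₁.real 2 (by decide)]
      simp [State.writeReal]
    have e18 : s₂.real 18 0 0 = 3 * ((n : ℝ) + 1) ^ 5 := by
      rw [hF₂.real 18 (by decide)]
      simp [State.writeReal, RExpr.eval, NExpr.eval, h₁]
      ring
    simp only [Test.Holds, RExpr.eval, NExpr.eval, e2, e18, h9r] at hb
    rw [← lt_div_iff₀ hε0] at hb
    have hlt : s₂.nat 9 0 0 < gridRadius n ε := Nat.lt_ceil.2 hb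
    refine Halts.seq_left (T := 20) (T' := 20) (Halts.setReal ?_)
    refine Halts.setNat ⟨v - 1, by omega, ?_, ?_⟩
    · simp [State.writeNat, State.writeReal, NExpr.eval]; omega
    · simp [State.writeNat, State.writeReal, NExpr.eval, RExpr.eval, h9r]
  · exact Nat.mul_le_mul_left _ (by simp [Test.cost, NExpr.cost, RExpr.cost])
  · rintro s₂ hF₂ ⟨hb, v, hv, h9r⟩
    have e2 : s₂.real 2 0 0 = ε := by
      rw [hF₂.real 2 (by decide), ← hε, ← hF₁.real 2 (by decide)]
      simp [State.writeReal]
    have e18 : s₂.real 18 0 0 = 3 * ((n : ℝ) + 1) ^ 5 := by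
      rw [hF₂.real 18 (by decide)]
      simp [State.writeReal, RExpr.eval, NExpr.eval, h₁]
      ring
    simp only [Test.Holds, RExpr.eval, NExpr.eval, e2, e18, h9r, not_lt] at hb
    rw [← div_le_iff₀ hε0] at hb
    have hge : gridRadius n ε ≤ s₂.nat 9 0 0 := Nat.ceil_le.2 hb
    have : s₂.nat 9 0 0 = gridRadius n ε := by omega
    exact ⟨this, by rw [h9r, this]⟩

/-- List the points of the grids around the responses in real array `10`; the radius of the grids is
the sum of the absolute residuals of the stored candidate, or zero if there is none. Natural
variable `10` holds the length of the list, which starts with one arbitrary entry, so that it is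
not empty. -/
def buildGrid : Program :=
  .seq (setRealVar 20 (.div (realVar 16) (realVar 9)))
    (.seq (setNatVar 10 (.const 1))
      (forLoop 6 dimN (.seq (setRealVar 19 (.sub (realAt 1 (natVar 6)) (realVar 16)))
        (forLoop 7 (.add (.add (natVar 9) (natVar 9)) (.const 1))
          (.seq (setRealAt 10 (natVar 10) (realVar 19))
            (.seq (setNatVar 10 (.add (natVar 10) (.const 1)))
              (setRealVar 19 (.add (realVar 19) (realVar 20)))))))))

theorem halts_buildGrid (s : State) {n K : ℕ} {L : ℝ} (hn : s.nat 0 0 0 = n)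
    (hK : s.nat 9 0 0 = K) (hKr : s.real 9 0 0 = K) (hL : s.real 16 0 0 = L) :
    Halts buildGrid s (20 + (20 + (n + 1) * (20 + (K + K + 1 + 1) * (60 + 32) + 32))) fun s' =>
      s'.nat 10 0 0 = 1 + n * (K + K + 1) ∧ ∀ i < n, ∀ k < K + K + 1,
        ∃ c < s'.nat 10 0 0, s'.real 10 c 0 = s.real 1 i 0 - L + k * (L / K) := by
  refine Halts.seq_left (Halts.setReal ?_)
  refine Halts.seq_left (Halts.setNat ?_)
  set s₀ : State := (s.writeReal 20 0 0 (L / K)).writeNat 10 0 0 1 with hs₀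
  have es₀ : ∀ {p T Q}, Halts p s₀ T Q → Halts p ((s.writeReal 20 0 0
      (s.real 16 0 0 / s.real 9 0 0)).writeNat 10 0 0 1) T Q := by
    intro p T Q h
    rwa [hL, hKr]
  refine es₀ ?_
  refine Halts.forLoop (fun t s' => s'.nat 10 0 0 = 1 + t * (K + K + 1) ∧
    ∀ i < t, ∀ k < K + K + 1,
        ∃ c < s'.nat 10 0 0, s'.real 10 c 0 = s.real 1 i 0 - L + k * (L / K))
    (by decide) (by decide) ?_ ?_ ?_
  · intro s' hF
    simp [NExpr.eval, hF.nat 0 (by decide), s₀, State.writeNat, State.writeReal, hn]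
  · simp [s₀, State.writeNat]
  · intro t ht s₁ hF₁ ht₁ hI₁
    have e16 : s₁.real 16 0 0 = L := by
      rw [hF₁.real 16 (by decide)]
      simpa [s₀, State.writeNat, State.writeReal] using hL
    have e20 : s₁.real 20 0 0 = L / K := by
      rw [hF₁.real 20 (by decide)]
      simp [s₀, State.writeNat, State.writeReal]
    have e1 : s₁.real 1 = s.real 1 := by
      rw [hF₁.real 1 (by decide)]
      simp [s₀, State.writeNat, State.writeReal]
    have e9 : s₁.nat 9 0 0 = K := by
      rw [hF₁.nat 9 (by decide)]
      simpa [s₀, State.writeNat, State.writeReal] using hK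
    refine Halts.seq_left (Halts.setReal ?_)
    refine (Halts.forLoop (N := K + K + 1) (T := 60) (fun l s' =>
      s'.nat 10 0 0 = 1 + t * (K + K + 1) + l ∧
      s'.real 19 0 0 = s.real 1 t 0 - L + l * (L / K) ∧
      (∀ i < t, ∀ k < K + K + 1,
        ∃ c < s'.nat 10 0 0, s'.real 10 c 0 = s.real 1 i 0 - L + k * (L / K)) ∧
      ∀ k < l, ∃ c < s'.nat 10 0 0, s'.real 10 c 0 = s.real 1 t 0 - L + k * (L / K))
      (by decide) (by decide) ?_ ?_ ?_).weaken ?_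
    · intro s' hF
      simp [NExpr.eval, hF.nat 9 (by decide), State.writeReal, e9]
    · refine ⟨?_, ?_, ?_, ?_⟩
      · simpa [State.writeNat, State.writeReal] using hI₁.1
      · simp [State.writeNat, State.writeReal, RExpr.eval, NExpr.eval, ht₁, e1, e16]
      · simpa [State.writeNat, State.writeReal] using hI₁.2
      · simp
    · rintro l hl s₂ hF₂ hl₂ ⟨h10, h19, hold, hnew⟩
      have e20' : s₂.real 20 0 0 = L / K := by
        rw [hF₂.real 20 (by decide)]
        simpa [State.writeReal] using e20
      have hpres : ∀ z : ℝ, (∃ c < s₂.nat 10 0 0, s₂.real 10 c 0 = z) →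
          ∃ c < s₂.nat 10 0 0 + 1,
            (if c = s₂.nat 10 0 0 then s₂.real 19 0 0 else s₂.real 10 c 0) = z := by
        rintro z ⟨c, hc, hcz⟩
        exact ⟨c, by omega, by rwa [if_neg hc.ne]⟩
      refine Halts.seq_left (T := 20) (T' := 20 + 20) (Halts.setReal ?_)
      refine Halts.seq_left (Halts.setNat ?_)
      refine Halts.setReal ⟨?_, ?_, ?_, ?_⟩
      · simp [State.writeNat, State.writeReal, NExpr.eval, h10]
        omega
      · simp [State.writeNat, State.writeReal, NExpr.eval, RExpr.eval, h19, e20']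
        ring
      · intro i hi k hk
        simpa [State.writeNat, State.writeReal, NExpr.eval, RExpr.eval] using
          hpres _ (hold i hi k hk)
      · intro k hk
        rcases Nat.lt_succ_iff_lt_or_eq.1 hk with hk | rfl
        · simpa [State.writeNat, State.writeReal, NExpr.eval, RExpr.eval] using
            hpres _ (hnew k hk)
        · refine ⟨s₂.nat 10 0 0, ?_, ?_⟩
          · simp [State.writeNat, State.writeReal, NExpr.eval]
          · simpa [State.writeNat, State.writeReal, NExpr.eval, RExpr.eval] using h19
    · rintro s₂ - ⟨h10, -, hold, hnew⟩
      refine ⟨?_, ?_⟩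
      · simp only [State.writeNat, h10]
        simp
        ring
      · intro i hi
        have : ∀ k < K + K + 1,
            ∃ c < s₂.nat 10 0 0, s₂.real 10 c 0 = s.real 1 i 0 - L + k * (L / K) := by
          rcases Nat.lt_succ_iff_lt_or_eq.1 hi with hi | rfl
          · exact hold i hi
          · exact hnew
        simpa [State.writeNat] using this

/-- List the grid points and evaluate all vectors of coordinates with entries in the list. -/
def stage : Program := .seq buildGrid enumerate

/-- For `L = 0` the grids consist of the responses only. So the same program serves for the first
round, when no candidate has been stored and real variable `16` still holds zero. -/
theorem halts_stage (s : State) {n d K : ℕ} {A : Fin n → Fin d → ℝ} {y : Fin n → ℝ}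
    {S : Set ℝ} {L : ℝ} (hn : s.nat 0 0 0 = n) (hd : s.nat 0 0 1 = d)
    (hA : ∀ (i : Fin n) (j : Fin d), s.real 0 i j = A i j) (hy : ∀ i : Fin n, s.real 1 i 0 = y i)
    (hK : s.nat 9 0 0 = K) (hKr : s.real 9 0 0 = K) (hL : s.real 16 0 0 = L)
    (hB : HoldsBest s A y S) :
    Halts stage s (4000 * ((n + 2) ^ 2 * (d + 1) * (K + 1) * (1 + n * (K + K + 1)) ^ d)) fun s' =>
      s'.nat 16 0 0 = 1 ∧ HoldsBest s' A y (S ∪ {c | ∃ v : Fin d → ℝ,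
        (∀ j, ∃ i, ∃ k < K + K + 1, v j = y i - L + k * (L / K)) ∧
          c ∈ Set.range (leastSquaresObjective A y v)}) := by
  refine ((halts_buildGrid s hn hK hKr hL).seq fun s₁ hF₁ h₁ =>
    (halts_enumerate s₁ (A := A) (y := y) (S := S) (n := n) (d := d) ?_ ?_ ?_ ?_ h₁.1 (by omega)
      ?_).weaken fun s₂ hF₂ h₂ => ?_).time ?_
  · rw [hF₁.nat 0 (by decide), hn]
  · rw [hF₁.nat 0 (by decide), hd]
  · rw [hF₁.real 0 (by decide)]; exact hA
  · rw [hF₁.real 1 (by decide)]; exact hy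
  · exact hB.congr (hF₁.nat 16 (by decide)) (hF₁.nat 1 (by decide)) (hF₁.real 15 (by decide))
      (hF₁.real 16 (by decide)) (hF₁.real 17 (by decide))
  · refine ⟨h₂.1, h₂.2.mono ?_⟩
    rintro c (hc | ⟨v, hv, hc⟩)
    · exact .inl hc
    · refine .inr ⟨v, fun j => ?_, hc⟩
      obtain ⟨i, k, hk, hvj⟩ := hv j
      obtain ⟨c', hc', h⟩ := h₁.2 i i.2 k hk
      rw [h₁.1] at hc'
      exact ⟨c', hc', by rw [hvj, h, hy]⟩
  · have hG : 1 ≤ (1 + n * (K + K + 1)) ^ d := Nat.one_le_pow _ _ (by omega)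
    generalize (1 + n * (K + K + 1)) ^ d = G at hG
    have e1 : 20 + (20 + (n + 1) * (20 + (K + K + 1 + 1) * (60 + 32) + 32)) ≤
        1000 * ((n + 2) ^ 2 * (d + 1) * (K + 1) * 1) := by
      have : 20 + (20 + (n + 1) * (20 + (K + K + 1 + 1) * (60 + 32) + 32)) ≤
          1000 * ((n + 2) ^ 2 * 1 * (K + 1) * 1) := by
        ring_nf
        nlinarith [Nat.zero_le (n * K), Nat.zero_le (n ^ 2 * K)]
      refine this.trans ?_
      gcongr
      omega
    have e2 : 1000 * ((n + 2) ^ 2 * (d + 1) * (K + 1) * 1) ≤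
        1000 * ((n + 2) ^ 2 * (d + 1) * (K + 1) * G) := by gcongr
    have e3 : 3000 * ((n + 2) ^ 2 * (d + 1) * G) = 3000 * ((n + 2) ^ 2 * (d + 1) * 1 * G) := by
      ring
    have e4 : 3000 * ((n + 2) ^ 2 * (d + 1) * 1 * G) ≤
        3000 * ((n + 2) ^ 2 * (d + 1) * (K + 1) * G) := by gcongr; omega
    omega

/-- The algorithm: change to a basis in which all data points have coordinates at most one,
evaluate all vectors of coordinates that are responses, then refine by grids around the
responses, and finally change back to the original coordinates. -/
def regression : Program :=
  .seq findBasis (.seq computeRadius (.seq stage (.seq stage (matVec 3 4 17 dimD))))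

/-- A bound for the running time of `regression`. -/
def regressionTime (n d K : ℕ) : ℕ :=
  1000 * ((n + 2) ^ 2 * (d + 1) ^ 2 * (n + 1) ^ d) +
    (((n + 1) * 52 + (20 + (40 + (K + 1) * 60))) +
      (4000 * ((n + 2) ^ 2 * (d + 1) * (K + 1) * (1 + n * (K + K + 1)) ^ d) +
        (4000 * ((n + 2) ^ 2 * (d + 1) * (K + 1) * (1 + n * (K + K + 1)) ^ d) +
          (d + 1) * (20 + (d + 1) * 72 + 32))))

theorem approximatesWithin_regression {n d : ℕ} (x : Fin n → Fin d → ℝ) (y : Fin n → ℝ) {ε : ℝ}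
    (hε : 0 < ε) (hε1 : ε < 1) :
    ApproximatesWithin regression x y ε (regressionTime n d (gridRadius n ε)) := by
  suffices H : Halts regression (regressionInput x y ε) (regressionTime n d (gridRadius n ε))
      fun s => ∃ (w : Fin d → ℝ) (π : Equiv.Perm (Fin n)),
        RegressionOutput s w π ∧ IsApproxSolution x y ε w π by
    obtain ⟨s', t, he, ht, h⟩ := H
    exact ⟨s', t, he, by exact_mod_cast ht, h⟩
  set X : Matrix (Fin n) (Fin d) ℝ := Matrix.of x with hX
  set s := regressionInput x y ε with hs
  have hn : s.nat 0 0 0 = n := by simp [s, regressionInput]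
  have hd : s.nat 0 0 1 = d := by simp [s, regressionInput]
  refine (halts_findBasis s X hn hd ?_ ?_ ?_).seq fun s₁ hF₁ h₁ => ?_
  · intro i j
    simp [s, regressionInput, X]
  · simp [s, regressionInput]
  · simp [s, regressionInput]
  obtain ⟨b, T, hB, hnone, hle⟩ := h₁
  have e₁0 : s₁.nat 0 = s.nat 0 := hF₁.nat 0 (by decide)
  refine (halts_computeRadius s₁ (n := n) (ε := ε) (by rw [e₁0, hn]) ?_ hε ?_ ?_ ?_).seq
    fun s₂ hF₂ h₂ => ?_
  · rw [hF₁.real 2 (by decide)]; simp [s, regressionInput]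
  · rw [hF₁.real 8 (by decide)]; simp [s, regressionInput]
  · rw [hF₁.real 9 (by decide)]; simp [s, regressionInput]
  · rw [hF₁.nat 9 (by decide)]; simp [s, regressionInput]
  set K := gridRadius n ε with hKdef
  have e₂0 : s₂.nat 0 = s.nat 0 := by rw [hF₂.nat 0 (by decide), e₁0]
  have hA₂ : ∀ (i : Fin n) (j : Fin d), s₂.real 0 i j = (X * T) i j := by
    rw [hF₂.real 0 (by decide)]; exact hB.points
  have hy₂ : ∀ i : Fin n, s₂.real 1 i 0 = y i := by
    rw [hF₂.real 1 (by decide), hF₁.real 1 (by decide)]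
    intro i
    simp [s, regressionInput]
  refine (halts_stage s₂ (n := n) (d := d) (A := X * T) (y := y) (S := ∅) (by rw [e₂0, hn])
    (by rw [e₂0, hd]) hA₂ hy₂ h₂.1 h₂.2 (L := 0) ?_ (.inl ⟨?_, rfl⟩)).seq fun s₃ hF₃ h₃ => ?_
  · rw [hF₂.real 16 (by decide), hF₁.real 16 (by decide)]; simp [s, regressionInput]
  · rw [hF₂.nat 16 (by decide), hF₁.nat 16 (by decide)]; simp [s, regressionInput]
  obtain ⟨h₃16, h₃'⟩ := h₃
  obtain ⟨-, ⟨u, hu⟩, hmin⟩ : s₃.nat 16 0 0 = 1 ∧ _ := h₃'.resolve_left (by simp [h₃16])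
  obtain ⟨huj, σ, hσ, ho, hoσ, hl⟩ := hu
  have e₃0 : s₃.nat 0 = s.nat 0 := by rw [hF₃.nat 0 (by decide), e₂0]
  refine (halts_stage s₃ (n := n) (d := d) (A := X * T) (y := y) (S := {s₃.real 15 0 0})
    (K := K) (by rw [e₃0, hn])
    (by rw [e₃0, hd]) ?_ ?_ ?_ ?_ hl (.inr ⟨h₃16, ⟨u, huj, σ, hσ, ho, hoσ, hl⟩, ?_⟩)).seq
    fun s₄ hF₄ h₄ => ?_
  · rw [hF₃.real 0 (by decide)]; exact hA₂
  · rw [hF₃.real 1 (by decide)]; exact hy₂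
  · rw [hF₃.nat 9 (by decide)]; exact h₂.1
  · rw [hF₃.real 9 (by decide)]; exact h₂.2
  · rintro c rfl; exact le_rfl
  obtain ⟨h₄16, h₄'⟩ := h₄
  obtain ⟨-, ⟨u', hu'⟩, hmin'⟩ : s₄.nat 16 0 0 = 1 ∧ _ := h₄'.resolve_left (by simp [h₄16])
  obtain ⟨huj', σ', hσ', ho', -, -⟩ := hu'
  have e₄0 : s₄.nat 0 = s.nat 0 := by rw [hF₄.nat 0 (by decide), e₃0]
  refine (halts_matVec s₄ (n := d) (d := d) (by decide) (by decide) (by decide)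
    (fun s' h => by simp [NExpr.eval, h, e₄0, hd]) (by rw [e₄0, hd])).weaken fun s₅ hF₅ h₅ => ?_
  refine ⟨T.mulVec u', σ', ⟨fun j => ?_, fun i => ?_⟩, fun w' τ => ?_⟩
  · rw [h₅ j j.2, Finset.sum_range, Matrix.mulVec, dotProduct]
    refine Finset.sum_congr rfl fun k _ => ?_
    rw [huj', hF₄.real 4 (by decide), hF₃.real 4 (by decide), hF₂.real 4 (by decide), hB.transform]
  · rw [hF₅.nat 1 (by decide), hσ']
  · rcases Nat.eq_zero_or_pos n with rfl | hnpos
    · simp [leastSquaresObjective]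
    have hobj : leastSquaresObjective x y (T.mulVec u') σ' = s₄.real 15 0 0 := by
      rw [ho']
      refine Finset.sum_congr rfl fun i _ => ?_
      rw [← mulVec_dotProduct u' (σ' i)]
      rfl
    rw [hobj]
    refine approximation_guarantee (K := K) hB.mul_eq_one hnone hle hε hε1 ?_ ho ?_ ?_ ?_ hnpos w' τ
    · rw [← div_le_iff₀ hε]
      exact Nat.le_ceil _
    · intro v τ hv
      refine hmin _ (.inr ⟨v, fun j => ?_, τ, rfl⟩)
      obtain ⟨i, hi⟩ := hv j
      exact ⟨i, 0, by omega, by simp [hi]⟩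
    · exact hmin' _ (.inl rfl)
    · intro v τ hv
      exact hmin' _ (.inr ⟨v, hv, τ, rfl⟩)

end RealRAM

/-! ### Running time -/

theorem ApproximatesWithin.mono {p : RealRAM.Program} {n d : ℕ} {x : Fin n → Fin d → ℝ}
    {y : Fin n → ℝ} {ε T T' : ℝ} (h : ApproximatesWithin p x y ε T) (hT : T ≤ T') :
    ApproximatesWithin p x y ε T' := by
  obtain ⟨s, t, he, ht, hw⟩ := h
  exact ⟨s, t, he, ht.trans hT, hw⟩

namespace RealRAM

theorem regressionTime_le (n d K : ℕ) :
    regressionTime n d K ≤ 20000 * (d + 1) ^ 2 * ((n + 2) * (K + 2)) ^ (2 * d + 3) := by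
  set B := (n + 2) * (K + 2) with hB
  have hB4 : 4 ≤ B := Nat.mul_le_mul (show 2 ≤ n + 2 by omega) (show 2 ≤ K + 2 by omega)
  have hnB : n + 2 ≤ B := Nat.le_mul_of_pos_right _ (by omega)
  have hKB : K + 2 ≤ B := Nat.le_mul_of_pos_left _ (by omega)
  have hm : 1 + n * (K + K + 1) ≤ B ^ 2 := by
    have : 1 + n * (K + K + 1) ≤ 2 * B := by rw [hB]; ring_nf; omega
    nlinarith
  set G := B ^ (2 * d) with hG
  have hB1 : 1 ≤ B := by omega
  have hG1 : 1 ≤ G := Nat.one_le_pow _ _ (by omega)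
  have h1 : (n + 1) ^ d ≤ G := by
    calc (n + 1) ^ d ≤ B ^ d := by gcongr; omega
      _ ≤ B ^ (2 * d) := Nat.pow_le_pow_right hB1 (by omega)
  have h2 : (1 + n * (K + K + 1)) ^ d ≤ G := by
    rw [hG, pow_mul]; gcongr
  have hpow : B ^ (2 * d + 3) = B ^ 3 * G := by rw [hG, pow_add, mul_comm]
  rw [hpow]
  have hBB : B ^ 2 ≤ B ^ 3 := Nat.pow_le_pow_right hB1 (by omega)
  have hBB1 : B ≤ B ^ 3 := Nat.le_self_pow (by omega) _
  have hDD : d + 1 ≤ (d + 1) ^ 2 := Nat.le_self_pow (by omega) _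
  have hD1 : 1 ≤ (d + 1) ^ 2 := Nat.one_le_pow _ _ (by omega)
  set M := (d + 1) ^ 2 * (B ^ 3 * G) with hM
  have t1 : (n + 2) ^ 2 * (d + 1) ^ 2 * (n + 1) ^ d ≤ M := by
    calc _ ≤ B ^ 3 * (d + 1) ^ 2 * G :=
          Nat.mul_le_mul (Nat.mul_le_mul_right _ ((Nat.pow_le_pow_left hnB 2).trans hBB)) h1
      _ = M := by rw [hM]; ring
  have t2 : (n + 2) ^ 2 * (d + 1) * (K + 1) * (1 + n * (K + K + 1)) ^ d ≤ M := by
    calc _ ≤ B ^ 2 * (d + 1) ^ 2 * B * G := by gcongr; omega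
      _ = M := by rw [hM]; ring
  have t3 : B ≤ M := by
    calc B = 1 * (B * 1) := by ring
      _ ≤ M := by rw [hM]; gcongr
  have t4 : (d + 1) * (20 + (d + 1) * 72 + 32) ≤ 124 * M := by
    calc _ ≤ 124 * ((d + 1) ^ 2 * (1 * 1)) := by ring_nf; nlinarith
      _ ≤ 124 * M := by rw [hM]; gcongr; exact Nat.one_le_pow _ _ hB1
  rw [mul_assoc, ← hM, regressionTime]
  omega

theorem gridRadius_le {n : ℕ} {ε : ℝ} (hε : 0 < ε) :
    (gridRadius n ε : ℝ) ≤ 3 * ((n : ℝ) + 1) ^ 5 * (1 / ε) + 1 := by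
  have h : 0 ≤ 3 * ((n : ℝ) + 1) ^ 5 / ε := by positivity
  refine (Nat.ceil_lt_add_one h).le.trans (le_of_eq ?_)
  ring

theorem regressionTime_le_pow {n d : ℕ} {ε : ℝ} (hn : 2 ≤ n) (hd : 1 ≤ d) (hε : 0 < ε)
    (hε1 : ε < 1) : (regressionTime n d (gridRadius n ε) : ℝ) ≤ ((n : ℝ) / ε) ^ (97 * d) := by
  set z := (n : ℝ) / ε with hz
  have hn2 : (2 : ℝ) ≤ n := by exact_mod_cast hn
  have hnz : (n : ℝ) ≤ z := by
    rw [hz, le_div_iff₀ hε]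
    nlinarith
  have hz2 : 2 ≤ z := hn2.trans hnz
  have hz1 : 1 ≤ z := by linarith
  have hεz : 1 / ε ≤ z := by
    rw [hz]
    gcongr
    linarith
  have hzz : 2 * z ≤ z ^ 2 := by nlinarith
  have hK : (gridRadius n ε : ℝ) + 2 ≤ z ^ 14 := by
    have h1 : 3 * ((n : ℝ) + 1) ^ 5 * (1 / ε) ≤ z ^ 2 * (z ^ 2) ^ 5 * z := by
      gcongr
      · nlinarith
      · linarith
    have h2 : z ^ 2 ≤ z ^ 13 := pow_le_pow_right₀ hz1 (by norm_num)
    have h3 : 2 * z ^ 13 ≤ z ^ 14 := by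
      rw [pow_succ z 13]
      nlinarith [pow_pos (show 0 < z by linarith) 13]
    have h4 := gridRadius_le (n := n) hε
    nlinarith
  have hB : ((n : ℝ) + 2) * ((gridRadius n ε : ℝ) + 2) ≤ z ^ 16 := by
    calc _ ≤ z ^ 2 * z ^ 14 := by gcongr; linarith
      _ = z ^ 16 := by ring
  have hD : ((d : ℝ) + 1) ^ 2 ≤ z ^ (2 * d) := by
    have h1 : ((d : ℝ) + 1) ≤ 2 ^ d := by
      exact_mod_cast Nat.lt_two_pow_self
    calc ((d : ℝ) + 1) ^ 2 ≤ (2 ^ d) ^ 2 := by gcongr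
      _ ≤ (z ^ d) ^ 2 := by gcongr
      _ = z ^ (2 * d) := by rw [← pow_mul, mul_comm]
  have hc : (20000 : ℝ) ≤ z ^ 15 :=
    le_trans (by norm_num) (pow_le_pow_left₀ (by norm_num) hz2 15)
  have h := regressionTime_le n d (gridRadius n ε)
  calc (regressionTime n d (gridRadius n ε) : ℝ)
      ≤ 20000 * ((d : ℝ) + 1) ^ 2 *
        (((n : ℝ) + 2) * ((gridRadius n ε : ℝ) + 2)) ^ (2 * d + 3) := by exact_mod_cast h
    _ ≤ z ^ 15 * z ^ (2 * d) * (z ^ 16) ^ (2 * d + 3) := by gcongr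
    _ = z ^ (15 + 2 * d + 16 * (2 * d + 3)) := by rw [← pow_mul, ← pow_add, ← pow_add]
    _ ≤ z ^ (97 * d) := pow_le_pow_right₀ hz1 (by omega)

theorem regressionTime_le_of_dim (d n : ℕ) {ε : ℝ} (hε : 0 < ε) (hε1 : ε < 1) :
    (regressionTime n d (gridRadius n ε) : ℝ) ≤
      ((20000 * (d + 1) ^ 2 * 12 ^ (2 * d + 3) + 7 * (2 * d + 3) : ℕ) : ℝ) *
        ((n : ℝ) + 1 / ε) ^ (20000 * (d + 1) ^ 2 * 12 ^ (2 * d + 3) + 7 * (2 * d + 3)) := by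
  set z := (n : ℝ) + 1 / ε with hz
  have hε' : 1 ≤ 1 / ε := by
    rw [le_div_iff₀ hε]
    linarith
  have hn0 : (0 : ℝ) ≤ n := Nat.cast_nonneg n
  have hnz : (n : ℝ) + 1 ≤ z := by linarith
  have hz1 : 1 ≤ z := by linarith
  have hεz : 1 / ε ≤ z := by linarith
  have hK : (gridRadius n ε : ℝ) + 2 ≤ 6 * z ^ 6 := by
    have h1 : 3 * ((n : ℝ) + 1) ^ 5 * (1 / ε) ≤ 3 * z ^ 5 * z := by gcongr
    have h2 : 1 ≤ z ^ 6 := one_le_pow₀ hz1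
    have h4 := gridRadius_le (n := n) hε
    nlinarith
  have hB : ((n : ℝ) + 2) * ((gridRadius n ε : ℝ) + 2) ≤ 12 * z ^ 7 := by
    calc _ ≤ (2 * z) * (6 * z ^ 6) := by gcongr; linarith
      _ = 12 * z ^ 7 := by ring
  have h := regressionTime_le n d (gridRadius n ε)
  calc (regressionTime n d (gridRadius n ε) : ℝ)
      ≤ 20000 * ((d : ℝ) + 1) ^ 2 *
        (((n : ℝ) + 2) * ((gridRadius n ε : ℝ) + 2)) ^ (2 * d + 3) := by exact_mod_cast h
    _ ≤ 20000 * ((d : ℝ) + 1) ^ 2 * (12 * z ^ 7) ^ (2 * d + 3) := by gcongr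
    _ = ((20000 * (d + 1) ^ 2 * 12 ^ (2 * d + 3) : ℕ) : ℝ) * z ^ (7 * (2 * d + 3)) := by
      push_cast
      rw [mul_pow, ← pow_mul]
      ring
    _ ≤ _ := by
      gcongr
      · exact Nat.le_add_right _ _
      · exact Nat.le_add_left _ _

end RealRAM

theorem mainTheorem3 :
    ∃ p : RealRAM.Program,
      (∃ C : ℕ, ∀ (n d : ℕ), 2 ≤ n → 1 ≤ d →
        ∀ (x : Fin n → Fin d → ℝ) (y : Fin n → ℝ) (ε : ℝ), 0 < ε → ε < 1 →
          ApproximatesWithin p x y ε (((n : ℝ) / ε) ^ (C * d))) ∧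
      (∀ d : ℕ, ∃ K : ℕ, ∀ (n : ℕ) (x : Fin n → Fin d → ℝ) (y : Fin n → ℝ) (ε : ℝ),
        0 < ε → ε < 1 →
          ApproximatesWithin p x y ε ((K : ℝ) * ((n : ℝ) + 1 / ε) ^ K)) :=
  ⟨RealRAM.regression,
    ⟨97, fun _ _ hn hd x y _ hε hε1 =>
      (RealRAM.approximatesWithin_regression x y hε hε1).mono
        (RealRAM.regressionTime_le_pow hn hd hε hε1)⟩,
    fun d => ⟨20000 * (d + 1) ^ 2 * 12 ^ (2 * d + 3) + 7 * (2 * d + 3), fun n x y _ hε hε1 =>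
      (RealRAM.approximatesWithin_regression x y hε hε1).mono
        (RealRAM.regressionTime_le_of_dim d n hε hε1)⟩⟩
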